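/- Let $\Omega\subseteq\mathbb{R}^d$ be open and convex, let $T>0$, and put $\Omega_T:=\Omega\times(0,T)$. Let $f:\Omega_T\to\mathbb{R}$ be continuous with $f\in W^{1,1}_{\mathrm{loc}}(\Omega_T)$, and denote by $\frac{\partial f}{\partial t}\in L^1_{\mathrm{loc}}(\Omega_T)$ and $\nabla f\in (L^1_{\mathrm{loc}}(\Omega_T))^d$ its weak time derivative and weak spatial gradient. Suppose that (a) for all $0<t_1<t_2<T$ and every continuously differentiable curve $x:[t_1,t_2]\to\Omega$, the function $t\mapsto f(x(t),t)$ is absolutely continuous on $[t_1,t_2]$; (b) for all $0<t_1<t_2<T$ and every absolutely continuous curve $x:[t_1,t_2]\to\Omega$, the set of those points of $\{(x(t),t): t\in[t_1,t_2]\}$ at which $f$ is not (totally) differentiable has one-dimensional Hausdorff measure zero. Let $C>0$, $p>1$, $r\in\mathbb{R}$, let $a\in L^1_{\mathrm{loc}}(0,T)$, and let $A$ be an antiderivative of $a$ on $(0,T)$, that is, $A(t)-A(s)=\int_s^t a(u)\,du$ for all $s,t\in(0,T)$. Put $q:=\frac{p}{p-1}$, $m:=\frac{r}{p-1}-1$,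 $\xi:=\frac1q\left(\frac{1}{pC}\right)^{q-1}$ and, for $0<t_1<t_2<T$, $I:=\int_{t_1}^{t_2}e^{m(p-1)A(t)}\,dt$. **Positive case.** Suppose that $f>0$ a.e. in $\Omega_T$ and that $$\frac{\partial f}{\partial t}+af\ \ge\ \frac{C|\nabla f|^p}{f^r}\qquad\text{a.e. in }\Omega_T. \tag{1}$$ Then for all $x_1,x_2\in\Omega$ and $0<t_1<t_2<T$: (i) if $r=p-1$, then $$f(x_2,t_2)\ \ge\ \frac{e^{A(t_1)}}{e^{A(t_2)}}\,f(x_1,t_1)\,\exp\left(-\frac{\xi|x_2-x_1|^q}{(t_2-t_1)^{q-1}}\right);$$ (ii) if $r>p-1$, then $$f(x_2,t_2)\ \ge\ \frac{e^{A(t_1)}}{e^{A(t_2)}}\,f(x_1,t_1)\left(1+m\,\xi\,|x_2-x_1|^q I^{1-q}[f(x_1,t_1)]^m e^{mA(t_1)}\right)^{-1/m};$$ (iii) if $r<p-1$, then $$[f(x_2,t_2)]^{|m|}\ \ge\ \left(\frac{e^{A(t_1)}}{e^{A(t_2)}}\right)^{|m|}\left([f(x_1,t_1)]^{|m|}-\frac{|m|\,\xi\,|x_2-x_1|^qI^{1-q}}{e^{|m|A(t_1)}}\right),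 \tag{2}$$ and if the quantity in the large parentheses in (2) is nonnegative, then $$f(x_2,t_2)\ \ge\ \frac{e^{A(t_1)}}{e^{A(t_2)}}\,f(x_1,t_1)\left(1-\frac{|m|\,\xi\,|x_2-x_1|^qI^{1-q}}{[f(x_1,t_1)]^{|m|}e^{|m|A(t_1)}}\right)^{1/|m|},$$ where the right-hand side is read as $0$ if $f(x_1,t_1)=0$. **Nonnegative case.** If instead $f\ge 0$ a.e. in $\Omega_T$ and (1) holds with $r=0$ (where $f^0=1$), then (2) holds, with $m=-1$, for all $x_1,x_2\in\Omega$ and $0<t_1<t_2<T$. -/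

import Mathlib

open MeasureTheory Set
open scoped ContDiff

/-- The space-time cylinder `Ω_T = Ω × (0, T)` in `ℝ^d × ℝ`. -/
def spaceTimeCylinder {d : ℕ} (Ω : Set (EuclideanSpace ℝ (Fin d))) (T : ℝ) :
    Set (EuclideanSpace ℝ (Fin d) × ℝ) :=
  Ω ×ˢ Ioo (0 : ℝ) T

/-- `g ∈ L¹_loc(U)` is the weak derivative of `f` on the open set `U` in the direction `v`:
`∫_U f ∂_v φ = - ∫_U g φ` for every test function `φ ∈ C_c^∞(U)`. -/
def HasWeakDerivOn {d : ℕ} (U : Set (EuclideanSpace ℝ (Fin d) × ℝ))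
    (f g : EuclideanSpace ℝ (Fin d) × ℝ → ℝ) (v : EuclideanSpace ℝ (Fin d) × ℝ) : Prop :=
  LocallyIntegrableOn g U volume ∧
    ∀ φ : EuclideanSpace ℝ (Fin d) × ℝ → ℝ,
      ContDiff ℝ ∞ φ → HasCompactSupport φ → tsupport φ ⊆ U →
        ∫ z in U, f z * fderiv ℝ φ z v = -∫ z in U, g z * φ z

/-- `f ∈ W^{1,1}_loc(U)`, with weak time derivative `ft` and weak spatial gradient `gradf`. -/
structure IsW11locWith {d : ℕ} (U : Set (EuclideanSpace ℝ (Fin d) × ℝ))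
    (f ft : EuclideanSpace ℝ (Fin d) × ℝ → ℝ)
    (gradf : EuclideanSpace ℝ (Fin d) × ℝ → EuclideanSpace ℝ (Fin d)) : Prop where
  locallyIntegrable : LocallyIntegrableOn f U volume
  time : HasWeakDerivOn U f ft (0, 1)
  space : ∀ i : Fin d,
    HasWeakDerivOn U f (fun z => gradf z i) (EuclideanSpace.single i (1 : ℝ), 0)

/-- `f` is absolutely continuous along every continuously differentiable curve
`x : [t₁, t₂] → Ω` with `0 < t₁ < t₂ < T`, i.e. `t ↦ f (x t, t)` is absolutely continuous. -/
def ACOnC1Curves {d : ℕ} (Ω : Set (EuclideanSpace ℝ (Fin d))) (T : ℝ)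
    (f : EuclideanSpace ℝ (Fin d) × ℝ → ℝ) : Prop :=
  ∀ (t₁ t₂ : ℝ) (x : ℝ → EuclideanSpace ℝ (Fin d)), 0 < t₁ → t₁ < t₂ → t₂ < T →
    ContDiffOn ℝ 1 x (Icc t₁ t₂) → MapsTo x (Icc t₁ t₂) Ω →
      AbsolutelyContinuousOnInterval (fun t => f (x t, t)) t₁ t₂

/-- The set of points of `Ω_T` at which `f` has no total derivative meets (the space-time image
`{(x t, t)}` of) every absolutely continuous curve `x : [t₁, t₂] → Ω`, `0 < t₁ < t₂ < T`, in a set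
of one-dimensional Hausdorff measure zero. (Nullity does not depend on which of the equivalent
product metrics on `ℝ^d × ℝ` is used.) -/
def NondiffNullOnACCurves {d : ℕ} (Ω : Set (EuclideanSpace ℝ (Fin d))) (T : ℝ)
    (f : EuclideanSpace ℝ (Fin d) × ℝ → ℝ) : Prop :=
  ∀ (t₁ t₂ : ℝ) (x : ℝ → EuclideanSpace ℝ (Fin d)), 0 < t₁ → t₁ < t₂ → t₂ < T →
    AbsolutelyContinuousOnInterval x t₁ t₂ → MapsTo x (Icc t₁ t₂) Ω →
      Measure.hausdorffMeasure 1
        ({z ∈ spaceTimeCylinder Ω T | ¬ DifferentiableAt ℝ f z} ∩ (fun t => (x t, t)) '' Icc t₁ t₂) = 0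

/-- `A` is an antiderivative on `(0, T)` of the locally integrable function `a`. -/
def IsAntiderivOn (a A : ℝ → ℝ) (T : ℝ) : Prop :=
  ∀ s ∈ Ioo (0 : ℝ) T, ∀ t ∈ Ioo (0 : ℝ) T, A t - A s = ∫ u in s..t, a u

/-- The gradient inequality `∂f/∂t + a f ≥ C |∇f|^p / f^r` a.e. in `Ω_T`. -/
def GradientIneq {d : ℕ} (Ω : Set (EuclideanSpace ℝ (Fin d))) (T C p r : ℝ) (a : ℝ → ℝ)
    (f ft : EuclideanSpace ℝ (Fin d) × ℝ → ℝ)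
    (gradf : EuclideanSpace ℝ (Fin d) × ℝ → EuclideanSpace ℝ (Fin d)) : Prop :=
  ∀ᵐ z ∂(volume.restrict (spaceTimeCylinder Ω T)),
    ft z + a z.2 * f z ≥ C * ‖gradf z‖ ^ p / f z ^ r

/-- `q = p / (p - 1)`. -/
noncomputable def conjExp (p : ℝ) : ℝ := p / (p - 1)

/-- `m = r / (p - 1) - 1`. -/
noncomputable def mExp (p r : ℝ) : ℝ := r / (p - 1) - 1

/-- `ξ = (1 / q) (1 / (p C))^(q - 1)`. -/
noncomputable def xiConst (p C : ℝ) : ℝ :=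
  1 / conjExp p * (1 / (p * C)) ^ (conjExp p - 1)

/-- `I = ∫_{t₁}^{t₂} e^{m (p - 1) A(t)} dt`. -/
noncomputable def weightInt (p r : ℝ) (A : ℝ → ℝ) (t₁ t₂ : ℝ) : ℝ :=
  ∫ t in t₁..t₂, Real.exp (mExp p r * (p - 1) * A t)

/-! Take a curve x(t) from x₁ to x₂ in Ω and put w(t) = f(x(t), t). Formally w' = ∂f/∂t + ∇f·x'. By
the gradient inequality and a weighted Young inequality (`mul_le_gradient_add`), w' + a w + ξ|x'|^q
w^(m+1) ≥ 0. With W = e^A w and G'(u) = u^(-m-1), this says (G∘W)' ≥ -ξ|x'|^q e^(-mA), so G(W) drops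
by at most ξ∫|x'|^q e^(-mA). On a segment, Hölder makes the speed proportional to e^(m(p-1)A)
optimal, and the cost is then ξ|x₂-x₁|^q I^(1-q). The three cases are G = log, G = -u^(-m)/m and G =
u^|m|/|m|.

The inequality is known only a.e. in space-time, where a curve is a null set. Therefore the weak
derivatives are tested against ρ(y - x(t))ψ(t), with ρ a mollifier. All derivatives of ρ cancel, and
shrinking ρ gives the inequality for w in the distributional sense
(`IsW11locWith.integral_deriv_mul_le`). Since w is absolutely continuous, the distributional
inequality holds a.e., and `comparison_of_deriv_ge` integrates it.

Two points need care. Powers of f and G are controlled only where f > 0, while continuity gives just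
f ≥ 0 everywhere; `lower_bound_or_vanishing` handles a curve that meets a zero of f. The curves must
be smooth for the test functions to be admissible, while the optimal speed is merely continuous;
`exists_smooth_profile` approximates it at arbitrarily small extra cost. -/

/-! ### Mollification around a space-time curve -/

/-- The shear `(y, τ) ↦ (y + x τ, τ)` as a homeomorphism. -/
def shearHomeomorph {E : Type*} [NormedAddCommGroup E] (x : ℝ → E) (hx : Continuous x) :
    E × ℝ ≃ₜ E × ℝ where
  toFun p := (p.1 + x p.2, p.2)
  invFun p := (p.1 - x p.2, p.2)
  left_inv p := by simp
  right_inv p := by simp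
  continuous_toFun := by fun_prop
  continuous_invFun := by fun_prop

/-- On each time slice the shear is a translation. It straightens the curve x to the axis {0} × ℝ,
so that integrals against ρ(y - x(τ)) become product integrals. -/
theorem measurePreserving_shear {d : ℕ} (x : ℝ → EuclideanSpace ℝ (Fin d)) (hx : Continuous x) :
    MeasurePreserving (shearHomeomorph x hx) volume volume := by
  have h : MeasurePreserving
      (fun p : ℝ × EuclideanSpace ℝ (Fin d) => (id p.1, p.2 + x p.1))
      ((volume : Measure ℝ).prod volume) ((volume : Measure ℝ).prod volume) := by
    refine (MeasurePreserving.id volume).skew_product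
      (g := fun (t : ℝ) (y : EuclideanSpace ℝ (Fin d)) => y + x t) ?_ ?_
    · exact Continuous.measurable (by unfold Function.uncurry; fun_prop)
    · exact ae_of_all _ fun t => (measurePreserving_add_right volume (x t)).map_eq
  exact (Measure.measurePreserving_swap (μ := (volume : Measure ℝ))
    (ν := (volume : Measure (EuclideanSpace ℝ (Fin d))))).comp
    (h.comp (Measure.measurePreserving_swap (ν := (volume : Measure ℝ))
    (μ := (volume : Measure (EuclideanSpace ℝ (Fin d))))))

/-- Integrating `c(τ) g(z, τ)` against a mollifier concentrated around the curve `x` approximates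
the integral of `c(τ) g(x(τ), τ)`. -/
theorem exists_mollifier_radius {d : ℕ} {V : Set (EuclideanSpace ℝ (Fin d) × ℝ)} (hV : IsOpen V)
    {g : EuclideanSpace ℝ (Fin d) × ℝ → ℝ} (hg : ContinuousOn g V)
    {x : ℝ → EuclideanSpace ℝ (Fin d)} (hx : Continuous x) {K : Set ℝ} (hK : IsCompact K)
    (hKV : ∀ τ ∈ K, (x τ, τ) ∈ V) {c : ℝ → ℝ} (hc : Integrable c) (hcK : ∀ τ ∉ K, c τ = 0)
    {η : ℝ} (hη : 0 < η) :
    ∃ ε > 0, ∀ ρ : EuclideanSpace ℝ (Fin d) → ℝ, (∀ y, 0 ≤ ρ y) → ∫ y, ρ y = 1 →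
      (∀ y, ε ≤ ‖y‖ → ρ y = 0) →
      Integrable (fun z : EuclideanSpace ℝ (Fin d) × ℝ => c z.2 * g z * ρ (z.1 - x z.2)) ∧
      |(∫ z : EuclideanSpace ℝ (Fin d) × ℝ, c z.2 * g z * ρ (z.1 - x z.2)) -
        ∫ τ, c τ * g (x τ, τ)| ≤ η := by
  have hγ : Continuous fun τ => (x τ, τ) := by fun_prop
  have hKc : IsCompact ((fun τ => (x τ, τ)) '' K) := hK.image hγ
  have hKsub : (fun τ => (x τ, τ)) '' K ⊆ V := by rintro _ ⟨τ, hτ, rfl⟩; exact hKV τ hτ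
  obtain ⟨N, hN⟩ := hKc.exists_bound_of_continuousOn (hg.mono hKsub)
  set S : ℝ := 1 + ∫ τ, ‖c τ‖ with hS
  have hSpos : 0 < S := by have : 0 ≤ ∫ τ, ‖c τ‖ := integral_nonneg fun _ => norm_nonneg _
                           linarith
  set κ := η / S with hκ
  have hκpos : 0 < κ := by positivity
  have hu := hKc.uniformContinuousAt_of_continuousAt g
    (fun a ha => (hg a (hKsub ha)).continuousAt (hV.mem_nhds (hKsub ha)))
    (Metric.dist_mem_uniformity hκpos)
  obtain ⟨ε₁, hε₁, h₁⟩ := Metric.mem_uniformity_dist.1 hu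
  obtain ⟨ε₂, hε₂, h₂⟩ := hKc.exists_thickening_subset_open hV hKsub
  refine ⟨min ε₁ ε₂, lt_min hε₁ hε₂, fun ρ hρ0 hρ1 hρε => ?_⟩
  have hρi : Integrable ρ := integrable_of_integral_eq_one hρ1
  -- Wherever the weight c(τ)ρ(y) is nonzero, the sheared point lies in V and g there differs from
  -- its value on the curve by at most κ. Nothing is known about g off V, so every later estimate
  -- splits on whether the weight vanishes.
  have hclose : ∀ y τ, c τ * ρ y ≠ 0 →
      (y + x τ, τ) ∈ V ∧ |g (y + x τ, τ) - g (x τ, τ)| ≤ κ ∧ |g (x τ, τ)| ≤ N := by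
    intro y τ h
    have hτ : τ ∈ K := by by_contra h'; exact h (by simp [hcK τ h'])
    have hy : ‖y‖ < min ε₁ ε₂ := by by_contra! h'; exact h (by simp [hρε y h'])
    have hd : dist (x τ, τ) (y + x τ, τ) = ‖y‖ := by simp [Prod.dist_eq]
    refine ⟨h₂ ?_, ?_, hN _ ⟨τ, hτ, rfl⟩⟩
    · exact Metric.mem_thickening_iff.2
        ⟨_, ⟨τ, hτ, rfl⟩, by rw [dist_comm, hd]; exact hy.trans_le (min_le_right _ _)⟩
    · have := h₁ (a := (x τ, τ)) (b := (y + x τ, τ))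
        (by rw [hd]; exact hy.trans_le (min_le_left _ _)) ⟨τ, hτ, rfl⟩
      rw [abs_sub_comm]
      exact le_of_lt this
  have hmp := measurePreserving_shear x hx
  have hme := (shearHomeomorph x hx).measurableEmbedding
  set F := fun z : EuclideanSpace ℝ (Fin d) × ℝ => c z.2 * g z * ρ (z.1 - x z.2) with hF
  have hFS : F ∘ shearHomeomorph x hx = fun p => ρ p.1 * c p.2 * g (p.1 + x p.2, p.2) := by
    ext p; simp [F, shearHomeomorph]; ring
  have hprod : Integrable (fun p : EuclideanSpace ℝ (Fin d) × ℝ => ρ p.1 * c p.2) :=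
    hρi.mul_prod hc
  have hFSi : Integrable (F ∘ shearHomeomorph x hx) := by
    rw [hFS]
    have hVm : MeasurableSet ((shearHomeomorph x hx) ⁻¹' V) :=
      (hV.preimage (shearHomeomorph x hx).continuous).measurableSet
    have hgm : AEStronglyMeasurable
        (((shearHomeomorph x hx) ⁻¹' V).indicator (g ∘ shearHomeomorph x hx)) volume := by
      rw [aestronglyMeasurable_indicator_iff hVm]
      exact (hg.comp (shearHomeomorph x hx).continuous.continuousOn
        (fun _ h => h)).aestronglyMeasurable hVm
    refine (hprod.norm.const_mul (N + κ)).mono' ((hprod.1.mul hgm).congr ?_) ?_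
    · refine ae_of_all _ fun p => ?_
      by_cases h : c p.2 * ρ p.1 = 0
      · simp [mul_comm (ρ p.1), h]
      · have : p ∈ (shearHomeomorph x hx) ⁻¹' V := (hclose _ _ h).1
        simp only [Pi.mul_apply, indicator_of_mem this]
        rfl
    · refine ae_of_all _ fun p => ?_
      by_cases h : c p.2 * ρ p.1 = 0
      · simp [mul_comm (ρ p.1), h]
      · obtain ⟨-, h1, h2⟩ := hclose _ _ h
        rw [norm_mul, mul_comm]
        gcongr
        have := abs_sub_abs_le_abs_sub (g (p.1 + x p.2, p.2)) (g (x p.2, p.2))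
        rw [Real.norm_eq_abs]
        linarith
  have hFi : Integrable F := (hmp.integrable_comp_emb hme).1 hFSi
  refine ⟨hFi, ?_⟩
  have hcg : Integrable (fun τ => c τ * g (x τ, τ)) := by
    have hgK : ContinuousOn (fun τ => g (x τ, τ)) K :=
      hg.comp hγ.continuousOn hKV
    have := hgK.aestronglyMeasurable hK.measurableSet (μ := volume)
    rw [← aestronglyMeasurable_indicator_iff hK.measurableSet] at this
    refine (hc.norm.const_mul N).mono' ((hc.1.mul this).congr ?_) ?_
    · refine ae_of_all _ fun τ => ?_
      by_cases h : τ ∈ K <;> simp [h, hcK]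
    · refine ae_of_all _ fun τ => ?_
      by_cases h : τ ∈ K
      · rw [norm_mul, mul_comm]
        gcongr
        exact hN _ ⟨τ, h, rfl⟩
      · simp [hcK τ h]
  have hprod2 : Integrable (fun p : EuclideanSpace ℝ (Fin d) × ℝ =>
      ρ p.1 * (c p.2 * g (x p.2, p.2))) := hρi.mul_prod hcg
  have e1 : ∫ z, F z = ∫ p, (F ∘ shearHomeomorph x hx) p := (hmp.integral_comp hme F).symm
  have e2 : ∫ τ, c τ * g (x τ, τ) =
      ∫ p : EuclideanSpace ℝ (Fin d) × ℝ, ρ p.1 * (c p.2 * g (x p.2, p.2)) := by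
    have := integral_prod_mul (μ := (volume : Measure (EuclideanSpace ℝ (Fin d))))
      (ν := (volume : Measure ℝ)) ρ (fun τ => c τ * g (x τ, τ))
    rw [hρ1, one_mul] at this
    exact this.symm
  have e3 : ∫ p : EuclideanSpace ℝ (Fin d) × ℝ, ‖ρ p.1 * c p.2‖ = ∫ τ, ‖c τ‖ := by
    have := integral_prod_mul (μ := (volume : Measure (EuclideanSpace ℝ (Fin d))))
      (ν := (volume : Measure ℝ)) ρ (fun τ => ‖c τ‖)
    rw [hρ1, one_mul] at this
    rw [← this]
    exact integral_congr_ae (ae_of_all _ fun p => by simp [abs_of_nonneg (hρ0 _)])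
  rw [e1, e2, ← integral_sub hFSi hprod2]
  calc _ ≤ ∫ p : EuclideanSpace ℝ (Fin d) × ℝ, κ * ‖ρ p.1 * c p.2‖ := by
        rw [← Real.norm_eq_abs]
        refine norm_integral_le_of_norm_le (hprod.norm.const_mul κ) (ae_of_all _ fun p => ?_)
        rw [hFS]
        by_cases h : c p.2 * ρ p.1 = 0
        · have h' : ρ p.1 * c p.2 = 0 := by rw [mul_comm, h]
          simp [← mul_assoc, h']
        · rw [← mul_assoc, ← mul_sub, norm_mul, mul_comm]
          gcongr
          exact (hclose _ _ h).2.1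
    _ = κ * ∫ τ, ‖c τ‖ := by rw [integral_const_mul, e3]
    _ ≤ κ * S := by gcongr; linarith
    _ = η := by rw [hκ]; field_simp

/-! ### Weak derivatives tested near a curve -/

theorem MeasureTheory.LocallyIntegrableOn.integrable_mul_of_tsupport_subset {X : Type*}
    [TopologicalSpace X] [T2Space X] [MeasurableSpace X] [BorelSpace X] {μ : Measure X}
    {U : Set X} {g φ : X → ℝ}
    (hg : LocallyIntegrableOn g U μ) (hφ : Continuous φ)
    (hφc : HasCompactSupport φ) (hφU : tsupport φ ⊆ U) :
    Integrable (fun z => g z * φ z) μ := by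
  have hK : IsCompact (tsupport φ) := hφc
  have hgK : IntegrableOn g (tsupport φ) μ := hg.integrableOn_compact_subset hφU hK
  have : (fun z => g z * φ z) = fun z => (tsupport φ).indicator g z • φ z := by
    ext z
    by_cases h : z ∈ tsupport φ
    · simp [h]
    · simp [image_eq_zero_of_notMem_tsupport h]
  rw [this]
  exact ((integrable_indicator_iff hK.measurableSet).2
    hgK).locallyIntegrable.integrable_smul_right_of_hasCompactSupport hφ hφc

/-- The weak derivative in an arbitrary spatial direction. -/
theorem IsW11locWith.hasWeakDerivOn_space {d : ℕ} {U : Set (EuclideanSpace ℝ (Fin d) × ℝ)}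
    {f ft : EuclideanSpace ℝ (Fin d) × ℝ → ℝ}
    {gradf : EuclideanSpace ℝ (Fin d) × ℝ → EuclideanSpace ℝ (Fin d)}
    (h : IsW11locWith U f ft gradf) (e : EuclideanSpace ℝ (Fin d)) :
    HasWeakDerivOn U f (fun z => inner ℝ (gradf z) e) (e, 0) := by
  have hin : (fun z => inner ℝ (gradf z) e) = fun z => ∑ i, e i * gradf z i := by
    ext z
    simp [PiLp.inner_apply]
  have hloc : ∀ i, LocallyIntegrableOn (fun z => e i * gradf z i) U volume := fun i => by
    intro z hz
    obtain ⟨s, hs, hi⟩ := (h.space i).1 z hz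
    exact ⟨s, hs, Integrable.const_mul hi (e i)⟩
  refine ⟨?_, fun φ hφ hφc hφU => ?_⟩
  · rw [hin]
    intro z hz
    choose s hs hi using fun i => hloc i z hz
    refine ⟨⋂ i, s i, (Filter.iInter_mem).2 hs, ?_⟩
    exact integrable_finsetSum _ fun i _ => (hi i).mono_set (iInter_subset _ i)
  have he : ∀ z, fderiv ℝ φ z (e, 0) =
      ∑ i, e i * fderiv ℝ φ z (EuclideanSpace.single i (1 : ℝ), 0) := by
    intro z
    have : ((e, 0) : EuclideanSpace ℝ (Fin d) × ℝ) =
        ∑ i, e i • (EuclideanSpace.single i (1 : ℝ), (0 : ℝ)) := by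
      refine Prod.ext ?_ ?_
      · ext j
        simp [Prod.fst_sum, Finset.sum_apply, Pi.single_apply]
      · simp [Prod.snd_sum]
    rw [this, map_sum]
    simp only [map_smul, smul_eq_mul]
  have hφ' : ∀ v, Continuous fun z => fderiv ℝ φ z v := fun v =>
    (hφ.continuous_fderiv (by simp)).clm_apply continuous_const
  have hi1 : ∀ i, IntegrableOn
      (fun z => f z * fderiv ℝ φ z (EuclideanSpace.single i (1 : ℝ), 0)) U := fun i =>
    (h.locallyIntegrable.integrable_mul_of_tsupport_subset (hφ' _) (hφc.fderiv_apply ℝ _)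
      ((tsupport_fderiv_apply_subset ℝ _).trans hφU)).integrableOn
  have hi2 : ∀ i, IntegrableOn (fun z => gradf z i * φ z) U := fun i =>
    ((h.space i).1.integrable_mul_of_tsupport_subset hφ.continuous hφc hφU).integrableOn
  calc ∫ z in U, f z * fderiv ℝ φ z (e, 0)
      = ∫ z in U, ∑ i, e i * (f z * fderiv ℝ φ z (EuclideanSpace.single i (1 : ℝ), 0)) := by
        congr 1; ext z; rw [he, Finset.mul_sum]; congr 1; ext i; ring
    _ = ∑ i, e i * -∫ z in U, gradf z i * φ z := by
        rw [integral_finsetSum _ fun i _ => (hi1 i).const_mul _]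
        congr 1; ext i
        rw [integral_const_mul, (h.space i).2 φ hφ hφc hφU]
    _ = -∫ z in U, ∑ i, e i * (gradf z i * φ z) := by
        rw [integral_finsetSum _ fun i _ => (hi2 i).const_mul _, ← Finset.sum_neg_distrib]
        congr 1; ext i
        rw [integral_const_mul]; ring
    _ = _ := by
        rw [hin]; congr 2; ext z; rw [Finset.sum_mul]; congr 1; ext i; ring

/-- Derivative of a test function concentrated around the curve `x₁ + s(τ) e`. -/
theorem fderiv_curve_mollifier {d : ℕ} {ρ : EuclideanSpace ℝ (Fin d) → ℝ} (hρ : ContDiff ℝ ∞ ρ)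
    {ψ s : ℝ → ℝ} (hψ : ContDiff ℝ ∞ ψ) (hs : ContDiff ℝ ∞ s) (x₁ e v : EuclideanSpace ℝ (Fin d))
    (σ : ℝ) (z : EuclideanSpace ℝ (Fin d) × ℝ) :
    fderiv ℝ (fun z : EuclideanSpace ℝ (Fin d) × ℝ =>
      ρ (z.1 - (x₁ + s z.2 • e)) * ψ z.2) z (v, σ) =
      fderiv ℝ ρ (z.1 - (x₁ + s z.2 • e)) (v - (σ * deriv s z.2) • e) * ψ z.2 +
        ρ (z.1 - (x₁ + s z.2 • e)) * (σ * deriv ψ z.2) := by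
  have hs' : HasDerivAt s (deriv s z.2) z.2 :=
    (hs.differentiable (by simp) z.2).hasDerivAt
  have hψ' : HasDerivAt ψ (deriv ψ z.2) z.2 :=
    (hψ.differentiable (by simp) z.2).hasDerivAt
  have h2 : HasFDerivAt (fun z : EuclideanSpace ℝ (Fin d) × ℝ => z.2)
      (ContinuousLinearMap.snd ℝ _ ℝ) z := hasFDerivAt_snd
  have h1 : HasFDerivAt (fun z : EuclideanSpace ℝ (Fin d) × ℝ => z.1)
      (ContinuousLinearMap.fst ℝ _ ℝ) z := hasFDerivAt_fst
  have hin := h1.sub (((hs'.comp_hasFDerivAt z h2).smul_const e).const_add x₁)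
  have hρ' : HasFDerivAt ρ (fderiv ℝ ρ (z.1 - (x₁ + s z.2 • e))) (z.1 - (x₁ + s z.2 • e)) :=
    (hρ.differentiable (by simp) _).hasFDerivAt
  have := (hρ'.comp z hin).mul (hψ'.comp_hasFDerivAt z h2)
  have h := this.fderiv
  simp only [Function.comp_def, Pi.sub_apply] at h
  erw [h]
  simp
  ring

/-- A differential inequality a.e. near a smooth curve yields, in the weak sense, the differential
inequality along the curve. -/
theorem IsW11locWith.integral_deriv_mul_le {d : ℕ} {U V : Set (EuclideanSpace ℝ (Fin d) × ℝ)}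
    {f ft g : EuclideanSpace ℝ (Fin d) × ℝ → ℝ}
    {gradf : EuclideanSpace ℝ (Fin d) × ℝ → EuclideanSpace ℝ (Fin d)}
    (h : IsW11locWith U f ft gradf) (hV : IsOpen V) (hVU : V ⊆ U)
    (hf : ContinuousOn f V) (hg : ContinuousOn g V) {a β s ψ : ℝ → ℝ}
    {x₁ e : EuclideanSpace ℝ (Fin d)} (hβ : ContinuousOn β (tsupport ψ)) (hs : ContDiff ℝ ∞ s)
    (hψ : ContDiff ℝ ∞ ψ) (hψc : HasCompactSupport ψ) (hψ0 : ∀ τ, 0 ≤ ψ τ)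
    (hψV : ∀ τ ∈ tsupport ψ, (x₁ + s τ • e, τ) ∈ V) (ha : IntegrableOn a (tsupport ψ))
    (hineq : ∀ᵐ z ∂(volume.restrict U), z ∈ V →
      -(ft z + deriv s z.2 * inner ℝ (gradf z) e) ≤ a z.2 * f z + β z.2 * g z) :
    ∫ τ, deriv ψ τ * f (x₁ + s τ • e, τ) ≤
      (∫ τ, ψ τ * a τ * f (x₁ + s τ • e, τ)) + ∫ τ, ψ τ * β τ * g (x₁ + s τ • e, τ) := by
  have hK : IsCompact (tsupport ψ) := hψc
  have hx : Continuous fun τ => x₁ + s τ • e := by have := hs.continuous; fun_prop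
  have hψd : Continuous (deriv ψ) := hψ.continuous_deriv (by simp)
  have hind : ∀ b : ℝ → ℝ, IntegrableOn b (tsupport ψ) → Integrable fun τ => ψ τ * b τ := by
    intro b hb
    have : (fun τ => ψ τ * b τ) = fun z => ψ z • (tsupport ψ).indicator b z := by
      ext z
      by_cases h : z ∈ tsupport ψ
      · simp [h]
      · simp [image_eq_zero_of_notMem_tsupport h]
    rw [this]
    exact ((integrable_indicator_iff hK.measurableSet).2
      hb).locallyIntegrable.integrable_smul_left_of_hasCompactSupport hψ.continuous hψc
  have hψK : ∀ τ ∉ tsupport ψ, ψ τ = 0 := fun τ => image_eq_zero_of_notMem_tsupport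
  have hc1 : Integrable (deriv ψ) := hψd.integrable_of_hasCompactSupport hψc.deriv
  have hc2 := hind a ha
  have hc3 := hind β (hβ.integrableOn_compact hK)
  have hdK : ∀ τ ∉ tsupport ψ, deriv ψ τ = 0 := fun τ hτ =>
    image_eq_zero_of_notMem_tsupport fun h' => hτ (tsupport_deriv_subset h')
  refine le_of_forall_pos_le_add fun η hη => ?_
  obtain ⟨ε₁, hε₁, h₁⟩ := exists_mollifier_radius hV hf hx hK hψV hc1 hdK
    (show 0 < η / 3 by positivity)
  obtain ⟨ε₂, hε₂, h₂⟩ := exists_mollifier_radius hV hf hx hK hψV hc2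
    (fun τ hτ => by simp [hψK τ hτ]) (show 0 < η / 3 by positivity)
  obtain ⟨ε₃, hε₃, h₃⟩ := exists_mollifier_radius hV hg hx hK hψV hc3
    (fun τ hτ => by simp [hψK τ hτ]) (show 0 < η / 3 by positivity)
  obtain ⟨ε₄, hε₄, h₄⟩ := (hK.image (show Continuous fun τ => (x₁ + s τ • e, τ) by
    fun_prop)).exists_cthickening_subset_open hV (by rintro _ ⟨τ, hτ, rfl⟩; exact hψV τ hτ)
  set ε := min (min ε₁ ε₂) (min ε₃ ε₄) with hε
  have hεp : 0 < ε := by simp [ε, *]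
  let bump : ContDiffBump (0 : EuclideanSpace ℝ (Fin d)) :=
    ⟨ε / 2, ε, by positivity, by linarith⟩
  set ρ := bump.normed volume with hρdef
  have hρ : ContDiff ℝ ∞ ρ := bump.contDiff_normed
  have hρ0 : ∀ y, 0 ≤ ρ y := fun y => bump.nonneg_normed y
  have hρ1 : ∫ y, ρ y = 1 := bump.integral_normed
  have hρε : ∀ y, ε ≤ ‖y‖ → ρ y = 0 := fun y hy => by
    by_contra h'
    have : y ∈ Function.support ρ := h'
    rw [hρdef, bump.support_normed_eq] at this
    simp [bump] at this
    linarith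
  have l1 : ε ≤ ε₁ := (min_le_left _ _).trans (min_le_left _ _)
  have l2 : ε ≤ ε₂ := (min_le_left _ _).trans (min_le_right _ _)
  have l3 : ε ≤ ε₃ := (min_le_right _ _).trans (min_le_left _ _)
  have l4 : ε ≤ ε₄ := (min_le_right _ _).trans (min_le_right _ _)
  obtain ⟨i1, b1⟩ := h₁ ρ hρ0 hρ1 fun y hy => hρε y (l1.trans hy)
  obtain ⟨i2, b2⟩ := h₂ ρ hρ0 hρ1 fun y hy => hρε y (l2.trans hy)
  obtain ⟨i3, b3⟩ := h₃ ρ hρ0 hρ1 fun y hy => hρε y (l3.trans hy)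
  -- support of the test functions
  set Q := (shearHomeomorph _ hx) '' (Metric.closedBall 0 ε ×ˢ tsupport ψ) with hQ
  have hQc : IsCompact Q :=
    ((isCompact_closedBall 0 ε).prod hK).image (shearHomeomorph _ hx).continuous
  have hQV : Q ⊆ V := by
    rintro _ ⟨⟨y, τ⟩, ⟨hy, hτ⟩, rfl⟩
    refine h₄ (Metric.mem_cthickening_of_dist_le _ (x₁ + s τ • e, τ) _ _ ⟨τ, hτ, rfl⟩ ?_)
    simp only [mem_closedBall_zero_iff] at hy
    simpa [shearHomeomorph, Prod.dist_eq] using hy.trans l4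
  have hsupp : ∀ χ : ℝ → ℝ, (∀ τ ∉ tsupport ψ, χ τ = 0) →
      Function.support (fun z : EuclideanSpace ℝ (Fin d) × ℝ =>
        ρ (z.1 - (x₁ + s z.2 • e)) * χ z.2) ⊆ Q := by
    intro χ hχ z hz
    refine ⟨(z.1 - (x₁ + s z.2 • e), z.2), ⟨?_, ?_⟩, by simp [shearHomeomorph]⟩
    · by_contra h'
      refine hz ?_
      simp only [mem_closedBall_zero_iff, not_le] at h'
      simp [hρε _ h'.le]
    · by_contra h'
      exact hz (by simp [hχ _ h'])
  have htest : ∀ χ : ℝ → ℝ, ContDiff ℝ ∞ χ → (∀ τ ∉ tsupport ψ, χ τ = 0) →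
      ContDiff ℝ ∞ (fun z : EuclideanSpace ℝ (Fin d) × ℝ =>
        ρ (z.1 - (x₁ + s z.2 • e)) * χ z.2) ∧
      HasCompactSupport (fun z : EuclideanSpace ℝ (Fin d) × ℝ =>
        ρ (z.1 - (x₁ + s z.2 • e)) * χ z.2) ∧
      tsupport (fun z : EuclideanSpace ℝ (Fin d) × ℝ =>
        ρ (z.1 - (x₁ + s z.2 • e)) * χ z.2) ⊆ U := by
    intro χ hχ hχ0
    have hts := closure_minimal (hsupp χ hχ0) hQc.isClosed
    refine ⟨by fun_prop, hQc.of_isClosed_subset (isClosed_tsupport _) hts,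
      hts.trans (hQV.trans hVU)⟩
  set φ : EuclideanSpace ℝ (Fin d) × ℝ → ℝ :=
    fun z => ρ (z.1 - (x₁ + s z.2 • e)) * ψ z.2 with hφ
  have hs' : ContDiff ℝ ∞ (deriv s) := by
    have : ContDiff ℝ (∞ + 1) s := by simpa using hs
    exact (contDiff_succ_iff_deriv.1 this).2.2
  -- The extra factor s' is part of the test function for the weak derivative in direction e: it
  -- produces the term s'∇f·e of the derivative along the curve.
  set φ₁ : EuclideanSpace ℝ (Fin d) × ℝ → ℝ :=
    fun z => ρ (z.1 - (x₁ + s z.2 • e)) * (ψ z.2 * deriv s z.2) with hφ₁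
  obtain ⟨p1, p2, p3⟩ := htest ψ hψ hψK
  obtain ⟨r1, r2, r3⟩ := htest (fun τ => ψ τ * deriv s τ) (hψ.mul hs')
    (fun τ hτ => by simp [hψK τ hτ])
  have hspace := h.hasWeakDerivOn_space e
  have w1 := h.time.2 φ p1 p2 p3
  have w2 := hspace.2 φ₁ r1 r2 r3
  have hcont : ∀ {χ : EuclideanSpace ℝ (Fin d) × ℝ → ℝ} (v), ContDiff ℝ ∞ χ →
    Continuous fun z => fderiv ℝ χ z v := fun v hχ =>
    (hχ.continuous_fderiv (by simp)).clm_apply continuous_const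
  have j1 : IntegrableOn (fun z => f z * fderiv ℝ φ z (0, 1)) U :=
    (h.locallyIntegrable.integrable_mul_of_tsupport_subset (hcont _ p1) (p2.fderiv_apply ℝ _)
      ((tsupport_fderiv_apply_subset ℝ _).trans p3)).integrableOn
  have j2 : IntegrableOn (fun z => f z * fderiv ℝ φ₁ z (e, 0)) U :=
    (h.locallyIntegrable.integrable_mul_of_tsupport_subset (hcont _ r1) (r2.fderiv_apply ℝ _)
      ((tsupport_fderiv_apply_subset ℝ _).trans r3)).integrableOn
  have k1 : IntegrableOn (fun z => ft z * φ z) U :=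
    (h.time.1.integrable_mul_of_tsupport_subset p1.continuous p2 p3).integrableOn
  have k2 : IntegrableOn (fun z => inner ℝ (gradf z) e * φ₁ z) U :=
    (hspace.1.integrable_mul_of_tsupport_subset r1.continuous r2 r3).integrableOn
  have hsetint : ∀ (χ : ℝ → ℝ) (b : EuclideanSpace ℝ (Fin d) × ℝ → ℝ),
      (∀ τ ∉ tsupport ψ, χ τ = 0) →
      ∫ z in U, χ z.2 * b z * ρ (z.1 - (x₁ + s z.2 • e)) =
        ∫ z, χ z.2 * b z * ρ (z.1 - (x₁ + s z.2 • e)) := by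
    intro χ b hχ
    refine setIntegral_eq_integral_of_forall_compl_eq_zero fun z hz => ?_
    have : z ∉ Function.support (fun z : EuclideanSpace ℝ (Fin d) × ℝ =>
        ρ (z.1 - (x₁ + s z.2 • e)) * χ z.2) := fun h' => hz (hVU (hQV (hsupp χ hχ h')))
    simp only [Function.mem_support, not_not] at this
    rw [mul_comm (χ _), mul_assoc, mul_comm (χ _), this, mul_zero]
  -- The time derivative of φ contributes -s'(∂_e ρ)ψ and the e-derivative of φ₁ contributes +s'(∂_e
  -- ρ)ψ. They cancel, leaving only ρψ', which converges as ρ concentrates.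
  have key : ∫ z in U, deriv ψ z.2 * f z * ρ (z.1 - (x₁ + s z.2 • e)) =
      ∫ z in U, -(ft z * φ z + inner ℝ (gradf z) e * φ₁ z) := by
    rw [integral_neg, integral_add k1 k2, neg_add, ← w1, ← w2, ← integral_add j1 j2]
    congr 1; ext z
    rw [hφ, hφ₁, fderiv_curve_mollifier hρ hψ hs, fderiv_curve_mollifier hρ (hψ.mul hs') hs]
    simp
    ring
  -- The pointwise inequality is multiplied by φ ≥ 0; off V both test functions vanish.
  have hle : ∫ z in U, -(ft z * φ z + inner ℝ (gradf z) e * φ₁ z) ≤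
      ∫ z in U, (ψ z.2 * a z.2 * f z * ρ (z.1 - (x₁ + s z.2 • e)) +
        ψ z.2 * β z.2 * g z * ρ (z.1 - (x₁ + s z.2 • e))) := by
    refine integral_mono_ae (k1.add k2).neg (i2.integrableOn.add i3.integrableOn) ?_
    filter_upwards [hineq] with z hz
    by_cases hzV : z ∈ V
    · have hnn : 0 ≤ φ z := mul_nonneg (hρ0 _) (hψ0 _)
      have := mul_le_mul_of_nonneg_right (hz hzV) hnn
      simp only [hφ, hφ₁] at this ⊢
      linarith
    · have : ρ (z.1 - (x₁ + s z.2 • e)) * ψ z.2 = 0 := by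
        by_contra h'
        exact hzV (hQV (hsupp ψ hψK h'))
      have e1 : φ z = 0 := this
      have e2 : φ₁ z = 0 := by simp only [hφ₁]; rw [← mul_assoc, this, zero_mul]
      have e3 : ∀ u v : ℝ, ψ z.2 * u * v * ρ (z.1 - (x₁ + s z.2 • e)) = 0 := fun u v => by
        linear_combination u * v * this
      simp [e1, e2, e3]
  rw [integral_add i2.integrableOn i3.integrableOn, ← key, hsetint _ _ hdK,
    hsetint (fun τ => ψ τ * a τ) f (fun τ hτ => by simp [hψK τ hτ]),
    hsetint (fun τ => ψ τ * β τ) g (fun τ hτ => by simp [hψK τ hτ])] at hle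
  have := abs_le.1 b1
  have := abs_le.1 b2
  have := abs_le.1 b3
  linarith

/-! ### Young's inequality and one-dimensional comparison -/

/-- The weighted Young inequality behind the gradient estimate. -/
theorem mul_le_gradient_add {C p r u P X : ℝ} (hC : 0 < C) (hp : 1 < p) (hu : 0 < u) (hP : 0 ≤ P)
    (hX : 0 ≤ X) :
    P * X ≤ C * P ^ p / u ^ r + xiConst p C * X ^ conjExp p * u ^ (mExp p r + 1) := by
  have hp0 : 0 < p := by linarith
  have hp1 : 0 < p - 1 := by linarith
  have hq : conjExp p - 1 = 1 / (p - 1) := by unfold conjExp; field_simp; ring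
  have hpq : p.HolderConjugate (conjExp p) := by
    rw [Real.holderConjugate_iff]
    refine ⟨hp, ?_⟩
    unfold conjExp; field_simp; ring
  -- The scaling k = (pC u^(-r))^(1/p) is the one for which (kP)^p / p is exactly C P^p / u^r; the
  -- constant ξ and the power u^(m+1) then come out of the conjugate term.
  set B := p * C * u ^ (-r) with hB
  have hBp : 0 < B := by positivity
  set k := B ^ (1 / p) with hk
  have hkp : 0 < k := by positivity
  have hy := Real.young_inequality_of_nonneg (a := k * P) (b := X / k) (by positivity)
    (by positivity) hpq
  have e0 : k * P * (X / k) = P * X := by field_simp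
  have e1 : (k * P) ^ p / p = C * P ^ p / u ^ r := by
    rw [Real.mul_rpow hkp.le hP, hk, ← Real.rpow_mul hBp.le, one_div_mul_cancel hp0.ne',
      Real.rpow_one, hB, Real.rpow_neg hu.le]
    field_simp
  have e2 : (X / k) ^ conjExp p / conjExp p =
      xiConst p C * X ^ conjExp p * u ^ (mExp p r + 1) := by
    have hkq : k ^ conjExp p = B ^ (conjExp p - 1) := by
      rw [hk, ← Real.rpow_mul hBp.le, hq]
      congr 1
      unfold conjExp; field_simp
    have hBq : (B ^ (conjExp p - 1))⁻¹ = (1 / (p * C)) ^ (conjExp p - 1) * u ^ (mExp p r + 1) := by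
      rw [← Real.inv_rpow hBp.le, hB, mul_inv, Real.mul_rpow (by positivity) (by positivity),
        one_div, Real.rpow_neg hu.le, inv_inv, ← Real.rpow_mul hu.le, hq]
      congr 2
      unfold mExp; field_simp; ring
    rw [Real.div_rpow hX hkp.le, hkq, div_eq_mul_inv (X ^ conjExp p), hBq]
    unfold xiConst
    ring
  rw [e0, e1, e2] at hy
  exact hy

/-- A function whose integral against nonnegative test functions is nonnegative is a.e.
nonnegative. -/
theorem ae_nonneg_of_forall_integral_contDiff_mul_nonneg {k : ℝ → ℝ} {t₁ t₂ : ℝ}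
    (hk : IntegrableOn k (Ioo t₁ t₂))
    (h : ∀ ψ : ℝ → ℝ, ContDiff ℝ ∞ ψ → HasCompactSupport ψ → (∀ τ, 0 ≤ ψ τ) →
      tsupport ψ ⊆ Ioo t₁ t₂ → 0 ≤ ∫ τ, ψ τ * k τ) :
    ∀ᵐ τ, τ ∈ Ioo t₁ t₂ → 0 ≤ k τ := by
  -- The outer and inner radii keep the fixed ratio 2 while shrinking, as required for a.e.
  -- convergence of the mollifications of a locally integrable function.
  let bump : ℕ → ContDiffBump (0 : ℝ) := fun n =>
    ⟨1 / ((n : ℝ) + 1), 2 * (1 / ((n : ℝ) + 1)), by positivity, by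
      have : 0 < 1 / ((n : ℝ) + 1) := by positivity
      linarith⟩
  have hout : Filter.Tendsto (fun n => (bump n).rOut) Filter.atTop (nhds 0) := by
    simpa [bump] using (tendsto_one_div_add_atTop_nhds_zero_nat (𝕜 := ℝ)).const_mul 2
  have hki : Integrable ((Ioo t₁ t₂).indicator k) :=
    (integrable_indicator_iff measurableSet_Ioo).2 hk
  filter_upwards [ContDiffBump.ae_convolution_tendsto_right_of_locallyIntegrable (K := 2)
    (φ := bump) hout (Filter.Eventually.of_forall fun n => le_rfl) hki.locallyIntegrable]
    with τ hτ hmem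
  rw [indicator_of_mem hmem] at hτ
  refine ge_of_tendsto hτ ?_
  obtain ⟨δ, hδ, hball⟩ := Metric.isOpen_iff.1 isOpen_Ioo τ hmem
  filter_upwards [hout.eventually (gt_mem_nhds hδ)] with n hn
  set ρ := (bump n).normed volume with hρ
  have hsupp : tsupport (fun t => ρ (τ - t)) ⊆ Metric.closedBall τ (bump n).rOut := by
    refine closure_minimal (fun t ht => ?_) Metric.isClosed_closedBall
    have : τ - t ∈ Function.support ρ := ht
    rw [hρ, (bump n).support_normed_eq] at this
    rw [Metric.mem_closedBall, dist_comm, Real.dist_eq]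
    simp only [Metric.mem_ball, dist_zero_right, Real.norm_eq_abs] at this
    exact this.le
  have hsub : Metric.closedBall τ (bump n).rOut ⊆ Ioo t₁ t₂ :=
    (Metric.closedBall_subset_ball hn).trans hball
  have hsm : ContDiff ℝ ∞ fun t => ρ (τ - t) :=
    (bump n).contDiff_normed.comp (contDiff_const.sub contDiff_id)
  have := h (fun t => ρ (τ - t)) hsm
    ((isCompact_closedBall _ _).of_isClosed_subset (isClosed_tsupport _) hsupp)
    (fun t => (bump n).nonneg_normed _) (hsupp.trans hsub)
  rw [convolution_eq_swap]
  refine this.trans_eq (integral_congr_ae (ae_of_all _ fun t => ?_))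
  by_cases ht : t ∈ Ioo t₁ t₂
  · simp [ht, hρ]
  · have : ρ (τ - t) = 0 :=
      image_eq_zero_of_notMem_tsupport (f := fun t => ρ (τ - t))
        fun h' => ht (hsub (hsupp h'))
    simp [ht, this]

theorem AbsolutelyContinuousOnInterval.comp_lipschitzOn {u G : ℝ → ℝ} {s t : ℝ} {D : Set ℝ}
    {L : NNReal} (hG : LipschitzOnWith L G D) (hu : AbsolutelyContinuousOnInterval u s t)
    (hmaps : MapsTo u (uIcc s t) D) : AbsolutelyContinuousOnInterval (fun τ => G (u τ)) s t := by
  rw [absolutelyContinuousOnInterval_iff] at hu ⊢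
  intro ε hε
  -- Dividing by L + 1 rather than L covers L = 0.
  obtain ⟨δ, hδ, h⟩ := hu (ε / (L + 1)) (by positivity)
  refine ⟨δ, hδ, fun E hE hlt => ?_⟩
  have h1 := h E hE hlt
  calc _ ≤ ∑ i ∈ Finset.range E.1, (L : ℝ) * dist (u (E.2 i).1) (u (E.2 i).2) :=
        Finset.sum_le_sum fun i hi =>
          hG.dist_le_mul _ (hmaps (hE.1 i hi).1) _ (hmaps (hE.1 i hi).2)
    _ = L * ∑ i ∈ Finset.range E.1, dist (u (E.2 i).1) (u (E.2 i).2) := by rw [Finset.mul_sum]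
    _ ≤ L * (ε / (L + 1)) := by gcongr
    _ < (L + 1) * (ε / (L + 1)) := by gcongr; linarith
    _ = ε := by field_simp

theorem AbsolutelyContinuousOnInterval.comp_contDiffOn_Icc {u G : ℝ → ℝ} {s t : ℝ} {c D : ℝ}
    (hG : ContDiffOn ℝ 1 G (Icc c D)) (hu : AbsolutelyContinuousOnInterval u s t)
    (hmaps : MapsTo u (uIcc s t) (Icc c D)) :
    AbsolutelyContinuousOnInterval (fun τ => G (u τ)) s t := by
  obtain ⟨L, hL⟩ := hG.exists_lipschitzOnWith (by decide) (convex_Icc _ _) isCompact_Icc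
  exact hu.comp_lipschitzOn hL hmaps

/-- Comparison for the differential inequality `w' ≥ -(a w + b w ^ (m + 1))` with `A' = a`, written
in terms of a function `G` with `G'(u) = u ^ (-m - 1)`. -/
theorem comparison_of_deriv_ge {w a A b G : ℝ → ℝ} {m s t : ℝ} (hst : s ≤ t)
    (hw : AbsolutelyContinuousOnInterval w s t) (hpos : ∀ τ ∈ Icc s t, 0 < w τ)
    (ha : IntervalIntegrable a volume s t) (hA : ∀ τ ∈ Icc s t, A τ - A s = ∫ u in s..τ, a u)
    (hb : ContinuousOn b (Icc s t)) (hG : ∀ u, 0 < u → HasDerivAt G (u ^ (-m - 1)) u)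
    (hineq : ∀ᵐ τ, τ ∈ Ioo s t → 0 ≤ deriv w τ + a τ * w τ + b τ * w τ ^ (m + 1)) :
    G (w s * Real.exp (A s)) - ∫ τ in s..t, b τ * Real.exp (-m * A τ) ≤
      G (w t * Real.exp (A t)) := by
  have hIcc : uIcc s t = Icc s t := uIcc_of_le hst
  -- B is A rewritten on [s, t] as an explicit primitive, which yields absolute continuity and B' =
  -- a a.e.
  set B : ℝ → ℝ := fun τ => A s + ∫ u in s..τ, a u with hBdef
  have hAB : ∀ τ ∈ Icc s t, A τ = B τ := fun τ hτ => by
    simp only [hBdef]; linarith [hA τ hτ]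
  have hconst : AbsolutelyContinuousOnInterval (fun _ => A s) s t :=
    (LipschitzWith.const (A s)).lipschitzOnWith.absolutelyContinuousOnInterval
  have hBac : AbsolutelyContinuousOnInterval B s t :=
    hconst.fun_add (ha.absolutelyContinuousOnInterval_intervalIntegral (by simp))
  obtain ⟨N, hN⟩ := hBac.exists_bound
  have hexp : AbsolutelyContinuousOnInterval (fun τ => Real.exp (B τ)) s t :=
    hBac.comp_contDiffOn_Icc (c := -N) (D := N) Real.contDiff_exp.contDiffOn
      fun τ hτ => abs_le.1 (hN τ hτ)
  have hWac : AbsolutelyContinuousOnInterval (fun τ => w τ * Real.exp (B τ)) s t :=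
    hw.fun_mul hexp
  have hWc := hWac.continuousOn
  rw [hIcc] at hWc
  -- G is C¹ only on (0, ∞). Between its minimum and maximum W = w e^B ranges in a compact
  -- subinterval of (0, ∞), where G is Lipschitz, so G∘W is absolutely continuous.
  obtain ⟨τ₀, hτ₀, hmin⟩ := isCompact_Icc.exists_isMinOn (nonempty_Icc.2 hst) hWc
  obtain ⟨τ₁, hτ₁, hmax⟩ := isCompact_Icc.exists_isMaxOn (nonempty_Icc.2 hst) hWc
  have hW0 : 0 < w τ₀ * Real.exp (B τ₀) := mul_pos (hpos _ hτ₀) (Real.exp_pos _)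
  have hGC : ContDiffOn ℝ 1 G (Ioi 0) := by
    rw [show (1 : WithTop ℕ∞) = 0 + 1 by simp,
      contDiffOn_succ_iff_deriv_of_isOpen isOpen_Ioi]
    refine ⟨fun u hu => (hG u hu).differentiableAt.differentiableWithinAt, by simp, ?_⟩
    rw [contDiffOn_zero]
    exact (continuousOn_id.rpow_const fun u hu => Or.inl (ne_of_gt hu)).congr
      fun u hu => (hG u hu).deriv
  have hGW : AbsolutelyContinuousOnInterval (fun τ => G (w τ * Real.exp (B τ))) s t := by
    refine hWac.comp_contDiffOn_Icc (c := w τ₀ * Real.exp (B τ₀)) (D := w τ₁ * Real.exp (B τ₁))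
      (hGC.mono fun u hu => hW0.trans_le hu.1) fun τ hτ => ?_
    rw [hIcc] at hτ
    exact ⟨hmin hτ, hmax hτ⟩
  have hBc : ContinuousOn B (Icc s t) := hIcc ▸ hBac.continuousOn
  have hbe : ContinuousOn (fun τ => b τ * Real.exp (-m * B τ)) (Icc s t) :=
    hb.mul (Real.continuous_exp.comp_continuousOn (continuousOn_const.mul hBc))
  have hint : ∫ τ in s..t, b τ * Real.exp (-m * A τ) =
      ∫ τ in s..t, b τ * Real.exp (-m * B τ) :=
    intervalIntegral.integral_congr fun τ hτ => by
      rw [hIcc] at hτ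
      simp only [hAB τ hτ]
  rw [hint, hAB s (left_mem_Icc.2 hst), hAB t (right_mem_Icc.2 hst)]
  have hftc := hGW.integral_deriv_eq_sub
  suffices h : ∫ τ in s..t, -(b τ * Real.exp (-m * B τ)) ≤
      ∫ τ in s..t, deriv (fun τ => G (w τ * Real.exp (B τ))) τ by
    rw [hftc, intervalIntegral.integral_neg] at h
    linarith
  refine intervalIntegral.integral_mono_ae_restrict hst ?_ hGW.intervalIntegrable_deriv ?_
  · exact (hbe.intervalIntegrable_of_Icc hst).neg
  rw [Filter.EventuallyLE, ← restrict_Ioo_eq_restrict_Icc, ae_restrict_iff' measurableSet_Ioo]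
  filter_upwards [hineq, hw.ae_differentiableAt, ha.ae_hasDerivAt_integral] with τ h1 h2 h3 hτ
  have hτI : τ ∈ Icc s t := Ioo_subset_Icc_self hτ
  have d1 := (h2 (hIcc ▸ hτI)).hasDerivAt
  have d2 : HasDerivAt B (a τ) τ := (h3 (hIcc ▸ hτI) s (by simp)).const_add (A s)
  have hwp := hpos τ hτI
  have hep := Real.exp_pos (B τ)
  have hWp : 0 < w τ * Real.exp (B τ) := mul_pos hwp hep
  have d3 := (hG _ hWp).comp τ (d1.mul d2.exp)
  have d4 : deriv (fun τ => G (w τ * Real.exp (B τ))) τ = _ := d3.deriv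
  rw [d4]
  have h1' := h1 hτ
  -- The integrating factor: multiplying the differential inequality by W^(-m-1) e^B > 0 turns its
  -- first two terms into (G∘W)' and reduces the last to b e^(-mB), free of w.
  have e1 : (w τ * Real.exp (B τ)) ^ (-m - 1) * (Real.exp (B τ) * w τ ^ (m + 1)) =
      Real.exp (-m * B τ) := by
    rw [Real.mul_rpow hwp.le hep.le, ← Real.exp_mul,
      show w τ ^ (-m - 1) * Real.exp (B τ * (-m - 1)) * (Real.exp (B τ) * w τ ^ (m + 1)) =
        (w τ ^ (-m - 1) * w τ ^ (m + 1)) * (Real.exp (B τ * (-m - 1)) * Real.exp (B τ)) by ring,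
      ← Real.rpow_add hwp, ← Real.exp_add]
    have : -m - 1 + (m + 1) = 0 := by ring
    rw [this, Real.rpow_zero, one_mul]
    congr 1; ring
  have hpp : 0 ≤ (w τ * Real.exp (B τ)) ^ (-m - 1) * Real.exp (B τ) := by positivity
  have := mul_nonneg hpp h1'
  rw [← e1]
  linarith

/-! ### The estimate along one smooth curve -/

/-- The estimate along a smooth curve on which `f` is positive. -/
theorem comparison_along_curve {d : ℕ} {Ω : Set (EuclideanSpace ℝ (Fin d))} (hΩo : IsOpen Ω)
    {T : ℝ} {f ft : EuclideanSpace ℝ (Fin d) × ℝ → ℝ}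
    {gradf : EuclideanSpace ℝ (Fin d) × ℝ → EuclideanSpace ℝ (Fin d)}
    (hfW : IsW11locWith (spaceTimeCylinder Ω T) f ft gradf)
    (hfc : ContinuousOn f (spaceTimeCylinder Ω T)) (hfAC : ACOnC1Curves Ω T f)
    {C p r : ℝ} (hC : 0 < C) (hp : 1 < p) {a A : ℝ → ℝ}
    (ha : LocallyIntegrableOn a (Ioo (0 : ℝ) T) volume) (hA : IsAntiderivOn a A T)
    (hgrad : GradientIneq Ω T C p r a f ft gradf)
    {x₁ e : EuclideanSpace ℝ (Fin d)} {s : ℝ → ℝ} (hs : ContDiff ℝ ∞ s) {t₁ t₂ : ℝ} (h0 : 0 < t₁)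
    (h12 : t₁ < t₂) (h2 : t₂ < T) (hΩ : ∀ τ ∈ Icc t₁ t₂, x₁ + s τ • e ∈ Ω)
    (hpos : ∀ τ ∈ Icc t₁ t₂, 0 < f (x₁ + s τ • e, τ)) {G : ℝ → ℝ}
    (hG : ∀ u, 0 < u → HasDerivAt G (u ^ (-mExp p r - 1)) u) :
    G (f (x₁ + s t₁ • e, t₁) * Real.exp (A t₁)) -
      ∫ τ in t₁..t₂, xiConst p C * (|deriv s τ| * ‖e‖) ^ conjExp p * Real.exp (-mExp p r * A τ) ≤
      G (f (x₁ + s t₂ • e, t₂) * Real.exp (A t₂)) := by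
  set U := spaceTimeCylinder Ω T with hU
  have hUo : IsOpen U := hΩo.prod isOpen_Ioo
  -- On the open set {f > 0} the function f^(m+1) is continuous for every real m, as the
  -- mollification argument needs.
  set V := {z ∈ U | 0 < f z} with hV
  have hVo : IsOpen V := hfc.isOpen_inter_preimage hUo isOpen_Ioi
  have hVU : V ⊆ U := fun z hz => hz.1
  have hq : 0 < conjExp p := div_pos (by linarith) (by linarith)
  have hsub : Icc t₁ t₂ ⊆ Ioo 0 T := fun τ hτ => ⟨h0.trans_le hτ.1, hτ.2.trans_lt h2⟩
  have hγV : ∀ τ ∈ Icc t₁ t₂, (x₁ + s τ • e, τ) ∈ V := fun τ hτ =>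
    ⟨⟨hΩ τ hτ, hsub hτ⟩, hpos τ hτ⟩
  set β : ℝ → ℝ := fun τ => xiConst p C * (|deriv s τ| * ‖e‖) ^ conjExp p with hβ
  have hs' : Continuous (deriv s) := hs.continuous_deriv (by simp)
  have hβc : Continuous β := by
    refine continuous_const.mul (Continuous.rpow_const (by fun_prop) fun τ => Or.inr hq.le)
  have hxc : ContDiff ℝ 1 fun τ => x₁ + s τ • e :=
    contDiff_const.add ((hs.of_le (by simp)).smul contDiff_const)
  have hw := hfAC t₁ t₂ (fun τ => x₁ + s τ • e) h0 h12 h2 hxc.contDiffOn hΩ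
  have haI : IntegrableOn a (Icc t₁ t₂) := ha.integrableOn_compact_subset hsub isCompact_Icc
  have haI' : IntervalIntegrable a volume t₁ t₂ :=
    (intervalIntegrable_iff_integrableOn_Icc_of_le h12.le).2 haI
  set w : ℝ → ℝ := fun τ => f (x₁ + s τ • e, τ) with hwdef
  have hwc : ContinuousOn w (Icc t₁ t₂) := uIcc_of_le h12.le ▸ hw.continuousOn
  have hgc : ContinuousOn (fun z => f z ^ (mExp p r + 1)) V :=
    (hfc.mono hVU).rpow_const fun z hz => Or.inl hz.2.ne'
  have hwm : ContinuousOn (fun τ => w τ ^ (mExp p r + 1)) (Icc t₁ t₂) :=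
    hwc.rpow_const fun τ hτ => Or.inl (hpos τ hτ).ne'
  have hineq : ∀ᵐ z ∂(volume.restrict U), z ∈ V →
      -(ft z + deriv s z.2 * inner ℝ (gradf z) e) ≤
        a z.2 * f z + β z.2 * f z ^ (mExp p r + 1) := by
    filter_upwards [hgrad] with z hz hzV
    have hy := mul_le_gradient_add (r := r) hC hp hzV.2 (norm_nonneg (gradf z))
      (X := |deriv s z.2| * ‖e‖) (by positivity)
    have hcs : -(deriv s z.2 * inner ℝ (gradf z) e) ≤ ‖gradf z‖ * (|deriv s z.2| * ‖e‖) := by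
      refine (neg_le_abs _).trans ?_
      rw [abs_mul, mul_left_comm]
      gcongr
      exact abs_real_inner_le_norm _ _
    simp only [hβ]
    linarith
  have i1 : IntegrableOn (deriv w) (Icc t₁ t₂) :=
    (intervalIntegrable_iff_integrableOn_Icc_of_le h12.le).1 hw.intervalIntegrable_deriv
  have i2 : IntegrableOn (fun τ => a τ * w τ) (Icc t₁ t₂) :=
    haI.mul_continuousOn hwc isCompact_Icc
  have i3 : IntegrableOn (fun τ => β τ * w τ ^ (mExp p r + 1)) (Icc t₁ t₂) :=
    (hβc.continuousOn.mul hwm).integrableOn_Icc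
  refine comparison_of_deriv_ge h12.le hw hpos haI'
    (fun τ hτ => hA t₁ (hsub (left_mem_Icc.2 h12.le)) τ (hsub hτ)) hβc.continuousOn hG ?_
  refine ae_nonneg_of_forall_integral_contDiff_mul_nonneg
    (((i1.add i2).add i3).mono_set Ioo_subset_Icc_self) fun ψ hψ hψc hψ0 hψs => ?_
  have hψI : tsupport ψ ⊆ Icc t₁ t₂ := hψs.trans Ioo_subset_Icc_self
  have hmain := hfW.integral_deriv_mul_le hVo hVU (hfc.mono hVU) hgc (a := a) (β := β) (s := s)
    (x₁ := x₁) (e := e) hβc.continuousOn hs hψ hψc hψ0 (fun τ hτ => hγV τ (hψI hτ))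
    (haI.mono_set hψI) hineq
  have hout : ∀ τ ∉ Icc t₁ t₂, ψ τ = 0 := fun τ hτ =>
    image_eq_zero_of_notMem_tsupport fun h' => hτ (hψI h')
  have hend : ψ t₁ = 0 ∧ ψ t₂ = 0 :=
    ⟨image_eq_zero_of_notMem_tsupport fun h' => lt_irrefl _ (hψs h').1,
      image_eq_zero_of_notMem_tsupport fun h' => lt_irrefl _ (hψs h').2⟩
  have hmul : ∀ b : ℝ → ℝ, IntegrableOn b (Icc t₁ t₂) → Integrable fun τ => ψ τ * b τ := by
    intro b hb
    have : (fun τ => ψ τ * b τ) = fun τ => (Icc t₁ t₂).indicator (fun τ => ψ τ * b τ) τ := by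
      ext τ
      by_cases h : τ ∈ Icc t₁ t₂
      · simp only [indicator_of_mem h]
      · simp only [indicator_of_notMem h, hout τ h, zero_mul]
    rw [this, integrable_indicator_iff measurableSet_Icc]
    exact hb.continuousOn_mul hψ.continuous.continuousOn isCompact_Icc
  have hψAC : AbsolutelyContinuousOnInterval ψ t₁ t₂ :=
    (hψ.of_le (by simp)).contDiffOn.absolutelyContinuousOnInterval
  -- Absolute continuity of w lets the derivative return from ψ to w; the boundary terms vanish
  -- because ψ is supported in the open interval.
  have hibp := hw.integral_mul_deriv_eq_deriv_mul hψAC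
  rw [hend.1, hend.2, mul_zero, mul_zero, sub_zero, zero_sub] at hibp
  have hfull : ∀ b : ℝ → ℝ, (∀ τ ∉ Ioc t₁ t₂, b τ = 0) → ∫ τ in t₁..t₂, b τ = ∫ τ, b τ := by
    intro b hb
    rw [intervalIntegral.integral_of_le h12.le]
    exact setIntegral_eq_integral_of_forall_compl_eq_zero hb
  have hout' : ∀ τ ∉ Ioc t₁ t₂, τ ∉ tsupport ψ := fun τ hτ h' =>
    hτ (Ioo_subset_Ioc_self (hψs h'))
  rw [hfull _ fun τ hτ => by
      rw [image_eq_zero_of_notMem_tsupport fun h' => hout' τ hτ (tsupport_deriv_subset h'),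
        mul_zero],
    hfull _ fun τ hτ => by
      rw [image_eq_zero_of_notMem_tsupport (hout' τ hτ), mul_zero]] at hibp
  have e1 : ∫ τ, ψ τ * (deriv w τ + a τ * w τ + β τ * w τ ^ (mExp p r + 1)) =
      (∫ τ, ψ τ * deriv w τ) + (∫ τ, ψ τ * (a τ * w τ)) +
        ∫ τ, ψ τ * (β τ * w τ ^ (mExp p r + 1)) := by
    rw [← integral_add (hmul _ i1) (hmul _ i2),
      ← integral_add (by exact (hmul _ i1).add (hmul _ i2)) (hmul _ i3)]
    congr 1; ext τ; ring
  have e2 : ∫ τ, ψ τ * deriv w τ = ∫ τ, deriv w τ * ψ τ := by simp_rw [mul_comm]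
  have e3 : ∫ τ, w τ * deriv ψ τ = ∫ τ, deriv ψ τ * w τ := by simp_rw [mul_comm]
  simp only [mul_assoc] at hmain
  change 0 ≤ ∫ τ, ψ τ * (deriv w τ + a τ * w τ + β τ * w τ ^ (mExp p r + 1))
  rw [e1, e2]
  rw [e3] at hibp
  linarith

/-! ### Zeros of the solution and the optimal time profile -/

/-- Continuation of a lower bound valid as long as `W` is positive: either it holds up to the end
or `W` tends to zero before. -/
theorem lower_bound_or_vanishing {W G : ℝ → ℝ} {c t₁ t₂ : ℝ} (h12 : t₁ < t₂)
    (hW : ContinuousOn W (Icc t₁ t₂)) (hnn : ∀ τ ∈ Icc t₁ t₂, 0 ≤ W τ) (h1 : 0 < W t₁)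
    (hstep : ∀ t ∈ Ioc t₁ t₂, (∀ τ ∈ Icc t₁ t, 0 < W τ) → c ≤ G (W t)) :
    (0 < W t₂ ∧ c ≤ G (W t₂)) ∨ ∀ δ > 0, ∃ u ∈ Ioo 0 δ, c ≤ G u := by
  by_cases hall : ∀ τ ∈ Icc t₁ t₂, 0 < W τ
  · exact Or.inl ⟨hall _ (right_mem_Icc.2 h12.le), hstep _ (right_mem_Ioc.2 h12) hall⟩
  right
  push Not at hall
  obtain ⟨z, hz, hWz⟩ := hall
  -- At the first zero t₀ the function W tends to 0 from the left through positive values, and the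
  -- bound holds at each earlier time; this supplies arbitrarily small u with c ≤ G u.
  have hZ : IsCompact (Icc t₁ t₂ ∩ W ⁻¹' {0}) :=
    isCompact_Icc.of_isClosed_subset (hW.preimage_isClosed_of_isClosed isClosed_Icc
      isClosed_singleton) inter_subset_left
  obtain ⟨t₀, ht₀, hleast⟩ := hZ.exists_isLeast ⟨z, hz, le_antisymm hWz (hnn z hz)⟩
  have hW0 : W t₀ = 0 := ht₀.2
  have h10 : t₁ < t₀ := lt_of_le_of_ne ht₀.1.1 fun h => by rw [h, hW0] at h1; exact lt_irrefl _ h1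
  have hbefore : ∀ τ, t₁ ≤ τ → τ < t₀ → 0 < W τ := fun τ h h' =>
    lt_of_le_of_ne (hnn τ ⟨h, h'.le.trans ht₀.1.2⟩) fun h'' =>
      absurd (hleast ⟨⟨h, h'.le.trans ht₀.1.2⟩, h''.symm⟩) (not_le.2 h')
  intro δ hδ
  have hev : ∀ᶠ τ in nhdsWithin t₀ (Ioo t₁ t₀), W τ < δ :=
    ((hW t₀ ht₀.1).mono fun τ hτ => ⟨hτ.1.le, hτ.2.le.trans ht₀.1.2⟩).eventually
      (gt_mem_nhds (by rw [hW0]; exact hδ))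
  have : (nhdsWithin t₀ (Ioo t₁ t₀)).NeBot := by
    rw [nhdsWithin_Ioo_eq_nhdsLT h10]; infer_instance
  obtain ⟨τ, hτ, hτ'⟩ := (hev.and self_mem_nhdsWithin).exists
  exact ⟨W τ, ⟨hbefore τ hτ'.1.le hτ'.2, hτ⟩,
    hstep τ ⟨hτ'.1, hτ'.2.le.trans ht₀.1.2⟩ fun σ hσ => hbefore σ hσ.1 (hσ.2.trans_lt hτ'.2)⟩

/-- Smooth approximations of the optimal time profile. -/
theorem exists_smooth_profile {E κ : ℝ → ℝ} {t₁ t₂ q J : ℝ} (h12 : t₁ < t₂) (hq : 0 < q)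
    (hE : ContinuousOn E (Icc t₁ t₂)) (hE0 : ∀ τ ∈ Icc t₁ t₂, 0 < E τ)
    (hκ : ContinuousOn κ (Icc t₁ t₂)) (hκ0 : ∀ τ ∈ Icc t₁ t₂, 0 ≤ κ τ)
    (hJ : (∫ τ in t₁..t₂, E τ) ^ (-q) * ∫ τ in t₁..t₂, E τ ^ q * κ τ < J) :
    ∃ s : ℝ → ℝ, ContDiff ℝ ∞ s ∧ s t₁ = 0 ∧ s t₂ = 1 ∧ (∀ τ ∈ Icc t₁ t₂, s τ ∈ Icc (0 : ℝ) 1) ∧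
      ∫ τ in t₁..t₂, |deriv s τ| ^ q * κ τ < J := by
  set I := ∫ τ in t₁..t₂, E τ with hI
  have hIpos : 0 < I := intervalIntegral.intervalIntegral_pos_of_pos_on
    (hE.intervalIntegrable_of_Icc h12.le) (fun τ hτ => hE0 τ (Ioo_subset_Icc_self hτ)) h12
  have hΙoc : uIoc t₁ t₂ ⊆ Icc t₁ t₂ := by
    rw [uIoc_of_le h12.le]; exact Ioc_subset_Icc_self
  have hpow : ∀ δ : ℝ, 0 ≤ δ → ContinuousOn (fun τ => (E τ + δ) ^ q * κ τ) (Icc t₁ t₂) :=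
    fun δ hδ => ((hE.add continuousOn_const).rpow_const fun τ _ => Or.inr hq.le).mul hκ
  have hlim : Filter.Tendsto (fun δ : ℝ => I ^ (-q) * ∫ τ in t₁..t₂, (E τ + δ) ^ q * κ τ)
      (nhdsWithin 0 (Ioo 0 1)) (nhds (I ^ (-q) * ∫ τ in t₁..t₂, E τ ^ q * κ τ)) := by
    refine Filter.Tendsto.const_mul _ ?_
    refine intervalIntegral.tendsto_integral_filter_of_dominated_convergence
      (fun τ => (E τ + 1) ^ q * κ τ) ?_ ?_
      ((hpow 1 zero_le_one).intervalIntegrable_of_Icc h12.le) ?_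
    · filter_upwards [self_mem_nhdsWithin] with δ hδ
      exact ((hpow δ hδ.1.le).mono hΙoc).aestronglyMeasurable measurableSet_uIoc
    · filter_upwards [self_mem_nhdsWithin] with δ hδ
      refine ae_of_all _ fun τ hτ => ?_
      have h1 := hE0 τ (hΙoc hτ)
      have h2 := hκ0 τ (hΙoc hτ)
      have h3 : 0 ≤ E τ + δ := by linarith [hδ.1]
      rw [Real.norm_of_nonneg (mul_nonneg (Real.rpow_nonneg h3 _) h2)]
      gcongr
      exact hδ.2.le
    · refine ae_of_all _ fun τ _ => ?_
      have : Continuous fun δ : ℝ => (E τ + δ) ^ q * κ τ :=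
        ((continuous_const.add continuous_id).rpow_const fun _ => Or.inr hq.le).mul
          continuous_const
      have := (this.tendsto 0).mono_left (nhdsWithin_le_nhds (s := Ioo (0 : ℝ) 1))
      simpa using this
  have : (nhdsWithin (0 : ℝ) (Ioo 0 1)).NeBot := by
    rw [nhdsWithin_Ioo_eq_nhdsGT zero_lt_one]; infer_instance
  obtain ⟨δ, hδJ, hδ⟩ := ((hlim.eventually (gt_mem_nhds hJ)).and self_mem_nhdsWithin).exists
  -- Approximating E + δ/2 within δ/2 gives E ≤ P ≤ E + δ. The lower bound makes P positive and its
  -- integral at least I, so normalizing does not raise the cost; the upper bound keeps the cost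
  -- below J.
  obtain ⟨P, hP⟩ := exists_polynomial_near_of_continuousOn t₁ t₂ (fun τ => E τ + δ / 2)
    (hE.add continuousOn_const) (δ / 2) (by linarith [hδ.1])
  have hPE : ∀ τ ∈ Icc t₁ t₂, E τ ≤ P.eval τ ∧ P.eval τ ≤ E τ + δ := fun τ hτ => by
    have := abs_lt.1 (hP τ hτ)
    constructor <;> linarith
  have hPc : Continuous fun τ => P.eval τ := P.continuous
  set N := ∫ τ in t₁..t₂, P.eval τ with hN
  have hIN : I ≤ N := intervalIntegral.integral_mono_on h12.le
    (hE.intervalIntegrable_of_Icc h12.le) (hPc.intervalIntegrable _ _) fun τ hτ => (hPE τ hτ).1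
  have hNpos : 0 < N := hIpos.trans_le hIN
  set s : ℝ → ℝ := fun τ => (∫ u in t₁..τ, P.eval u) / N with hs
  have hsd : ∀ τ, HasDerivAt s (P.eval τ / N) τ := fun τ =>
    (hPc.integral_hasStrictDerivAt t₁ τ).hasDerivAt.div_const N
  have hsd' : deriv s = fun τ => P.eval τ / N := funext fun τ => (hsd τ).deriv
  have hmono : MonotoneOn s (Icc t₁ t₂) := by
    refine monotoneOn_of_deriv_nonneg (convex_Icc _ _)
      (fun τ _ => (hsd τ).continuousAt.continuousWithinAt)
      (fun τ _ => (hsd τ).differentiableAt.differentiableWithinAt) fun τ hτ => ?_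
    rw [hsd']
    have hτ' := interior_subset hτ
    exact div_nonneg ((hE0 τ hτ').le.trans (hPE τ hτ').1) hNpos.le
  have hs1 : s t₁ = 0 := by simp [hs]
  have hs2 : s t₂ = 1 := by simp only [hs]; exact div_self hNpos.ne'
  refine ⟨s, ?_, hs1, hs2, fun τ hτ => ⟨?_, ?_⟩, ?_⟩
  · rw [contDiff_infty_iff_deriv, hsd']
    exact ⟨fun τ => (hsd τ).differentiableAt, (by simpa using P.contDiff_aeval (𝕜 := ℝ) ∞ : ContDiff ℝ ∞ fun τ => P.eval τ).div_const N⟩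
  · rw [← hs1]; exact hmono (left_mem_Icc.2 h12.le) hτ hτ.1
  · rw [← hs2]; exact hmono hτ (right_mem_Icc.2 h12.le) hτ.2
  refine lt_of_le_of_lt ?_ hδJ
  rw [← intervalIntegral.integral_const_mul, hsd']
  have hi : ContinuousOn (fun τ => |P.eval τ / N| ^ q * κ τ) (Icc t₁ t₂) :=
    (((hPc.div_const N).abs.rpow_const fun _ => Or.inr hq.le).continuousOn).mul hκ
  refine intervalIntegral.integral_mono_on h12.le (hi.intervalIntegrable_of_Icc h12.le)
    (((hpow δ hδ.1.le).intervalIntegrable_of_Icc h12.le).const_mul _) fun τ hτ => ?_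
  have h1 := hE0 τ hτ
  have h2 := hκ0 τ hτ
  obtain ⟨h3, h4⟩ := hPE τ hτ
  have h5 : 0 ≤ P.eval τ := h1.le.trans h3
  rw [abs_of_nonneg (div_nonneg h5 hNpos.le), ← mul_assoc]
  gcongr
  calc (P.eval τ / N) ^ q ≤ ((E τ + δ) / I) ^ q := by gcongr; linarith [hδ.1]
    _ = I ^ (-q) * (E τ + δ) ^ q := by
      rw [Real.div_rpow (by linarith [hδ.1]) hIpos.le, Real.rpow_neg hIpos.le, div_eq_inv_mul]

/-- Open sets are charged by the measure, so the continuous functions max(f, 0) and f, equal a.e. on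
U, agree on U. -/
theorem ContinuousOn.nonneg_of_ae_restrict {X : Type*} [TopologicalSpace X] [MeasurableSpace X]
    {μ : Measure X} [μ.IsOpenPosMeasure] {U : Set X} {f : X → ℝ} (hf : ContinuousOn f U)
    (hU : IsOpen U) (h : ∀ᵐ z ∂(μ.restrict U), 0 ≤ f z) : ∀ z ∈ U, 0 ≤ f z := by
  have : EqOn (fun z => max (f z) 0) f U :=
    Measure.eqOn_open_of_ae_eq (by filter_upwards [h] with z hz using max_eq_left hz) hU
      (ContinuousOn.sup hf continuousOn_const) hf
  exact fun z hz => (le_max_right _ _).trans_eq (this hz)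

theorem IsAntiderivOn.continuousOn_Icc {a A : ℝ → ℝ} {T t₁ t₂ : ℝ} (hA : IsAntiderivOn a A T)
    (ha : LocallyIntegrableOn a (Ioo (0 : ℝ) T) volume) (h0 : 0 < t₁) (h12 : t₁ ≤ t₂)
    (h2 : t₂ < T) : ContinuousOn A (Icc t₁ t₂) := by
  have hsub : Icc t₁ t₂ ⊆ Ioo 0 T := fun τ hτ => ⟨h0.trans_le hτ.1, hτ.2.trans_lt h2⟩
  have haI : IntegrableOn a (uIcc t₁ t₂) := by
    rw [uIcc_of_le h12]; exact ha.integrableOn_compact_subset hsub isCompact_Icc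
  have := intervalIntegral.continuousOn_primitive_interval haI
  rw [uIcc_of_le h12] at this
  refine (continuousOn_const (c := A t₁) |>.add this).congr fun τ hτ => ?_
  simp only [Pi.add_apply]
  linarith [hA t₁ (hsub (left_mem_Icc.2 h12)) τ (hsub hτ)]

theorem xiConst_pos {p C : ℝ} (hC : 0 < C) (hp : 1 < p) : 0 < xiConst p C := by
  have : 0 < conjExp p := div_pos (by linarith) (by linarith)
  have : 0 < p := by linarith
  unfold xiConst
  positivity

/-! ### Estimates between two points -/

/-- The integrated estimate between two points, before the passage to the optimal curve. -/
theorem comparison_between_points {d : ℕ} {Ω : Set (EuclideanSpace ℝ (Fin d))} (hΩo : IsOpen Ω)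
    (hΩc : Convex ℝ Ω) {T : ℝ} {f ft : EuclideanSpace ℝ (Fin d) × ℝ → ℝ}
    {gradf : EuclideanSpace ℝ (Fin d) × ℝ → EuclideanSpace ℝ (Fin d)}
    (hfW : IsW11locWith (spaceTimeCylinder Ω T) f ft gradf)
    (hfc : ContinuousOn f (spaceTimeCylinder Ω T)) (hfAC : ACOnC1Curves Ω T f)
    {C p r : ℝ} (hC : 0 < C) (hp : 1 < p) {a A : ℝ → ℝ}
    (ha : LocallyIntegrableOn a (Ioo (0 : ℝ) T) volume) (hA : IsAntiderivOn a A T)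
    (hnn : ∀ z ∈ spaceTimeCylinder Ω T, 0 ≤ f z)
    (hgrad : GradientIneq Ω T C p r a f ft gradf)
    {x₁ x₂ : EuclideanSpace ℝ (Fin d)} (hx₁ : x₁ ∈ Ω) (hx₂ : x₂ ∈ Ω) {t₁ t₂ : ℝ} (h0 : 0 < t₁)
    (h12 : t₁ < t₂) (h2 : t₂ < T) (hpos : 0 < f (x₁, t₁)) {G : ℝ → ℝ}
    (hG : ∀ u, 0 < u → HasDerivAt G (u ^ (-mExp p r - 1)) u) {J : ℝ}
    (hJ : weightInt p r A t₁ t₂ ^ (1 - conjExp p) < J) :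
    (0 < f (x₂, t₂) * Real.exp (A t₂) ∧
      G (f (x₁, t₁) * Real.exp (A t₁)) - xiConst p C * ‖x₂ - x₁‖ ^ conjExp p * J ≤
        G (f (x₂, t₂) * Real.exp (A t₂))) ∨
    ∀ δ > 0, ∃ u ∈ Ioo 0 δ,
      G (f (x₁, t₁) * Real.exp (A t₁)) - xiConst p C * ‖x₂ - x₁‖ ^ conjExp p * J ≤ G u := by
  set m := mExp p r with hm
  set q := conjExp p with hq
  have hq0 : 0 < q := div_pos (by linarith) (by linarith)
  have hpq : (p - 1) * q = p := by
    have : p - 1 ≠ 0 := by linarith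
    rw [hq]; unfold conjExp; field_simp
  have hξ := xiConst_pos hC hp
  have hAc := hA.continuousOn_Icc ha h0 h12.le h2
  have hEc : ContinuousOn (fun τ => Real.exp (m * (p - 1) * A τ)) (Icc t₁ t₂) :=
    Real.continuous_exp.comp_continuousOn (continuousOn_const.mul hAc)
  have hκc : ContinuousOn (fun τ => Real.exp (-m * A τ)) (Icc t₁ t₂) :=
    Real.continuous_exp.comp_continuousOn (continuousOn_const.mul hAc)
  have hIpos : 0 < ∫ τ in t₁..t₂, Real.exp (m * (p - 1) * A τ) :=
    intervalIntegral.intervalIntegral_pos_of_pos_on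
      (hEc.intervalIntegrable_of_Icc h12.le) (fun τ _ => Real.exp_pos _) h12
  have hJ' : (∫ τ in t₁..t₂, Real.exp (m * (p - 1) * A τ)) ^ (-q) *
      ∫ τ in t₁..t₂, Real.exp (m * (p - 1) * A τ) ^ q * Real.exp (-m * A τ) < J := by
    -- With E = e^(m(p-1)A) and κ = e^(-mA), the identity (p-1)q = p gives E^q κ = E, so the optimal
    -- cost I^(-q)∫E^q κ is I^(1-q).
    have : ∀ τ, Real.exp (m * (p - 1) * A τ) ^ q * Real.exp (-m * A τ) =
        Real.exp (m * (p - 1) * A τ) := fun τ => by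
      rw [← Real.exp_mul, ← Real.exp_add]
      congr 1
      linear_combination m * A τ * hpq
    simp_rw [this]
    refine lt_of_eq_of_lt ?_ hJ
    unfold weightInt
    rw [← hm, sub_eq_neg_add 1 q, Real.rpow_add hIpos, Real.rpow_one]
  obtain ⟨s, hs, hs1, hs2, hs01, hsJ⟩ := exists_smooth_profile h12 hq0 hEc
    (fun τ _ => Real.exp_pos _) hκc (fun τ _ => (Real.exp_pos _).le) hJ'
  have hΩs : ∀ τ ∈ Icc t₁ t₂, x₁ + s τ • (x₂ - x₁) ∈ Ω := fun τ hτ =>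
    hΩc.add_smul_sub_mem hx₁ hx₂ (hs01 τ hτ)
  have hend1 : x₁ + s t₁ • (x₂ - x₁) = x₁ := by simp [hs1]
  have hend2 : x₁ + s t₂ • (x₂ - x₁) = x₂ := by simp [hs2]
  have hsub : Icc t₁ t₂ ⊆ Ioo 0 T := fun τ hτ => ⟨h0.trans_le hτ.1, hτ.2.trans_lt h2⟩
  have hγU : ∀ τ ∈ Icc t₁ t₂, (x₁ + s τ • (x₂ - x₁), τ) ∈ spaceTimeCylinder Ω T :=
    fun τ hτ => ⟨hΩs τ hτ, hsub hτ⟩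
  have hsc := hs.continuous
  have hWc : ContinuousOn (fun τ => f (x₁ + s τ • (x₂ - x₁), τ) * Real.exp (A τ)) (Icc t₁ t₂) :=
    (hfc.comp (by fun_prop) hγU).mul (Real.continuous_exp.comp_continuousOn hAc)
  have := lower_bound_or_vanishing (G := G)
    (c := G (f (x₁, t₁) * Real.exp (A t₁)) - xiConst p C * ‖x₂ - x₁‖ ^ q * J) h12 hWc
    (fun τ hτ => mul_nonneg (hnn _ (hγU τ hτ)) (Real.exp_pos _).le)
    (by simp only [hend1]; exact mul_pos hpos (Real.exp_pos _)) ?_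
  · simpa only [hend2] using this
  intro t ht htpos
  have hcomp := comparison_along_curve hΩo hfW hfc hfAC hC hp ha hA hgrad (x₁ := x₁)
    (e := x₂ - x₁) hs h0 ht.1 (ht.2.trans_lt h2) (fun τ hτ => hΩs τ ⟨hτ.1, hτ.2.trans ht.2⟩)
    (fun τ hτ => pos_of_mul_pos_left (htpos τ hτ) (Real.exp_pos _).le) hG
  rw [hend1] at hcomp
  refine le_trans ?_ hcomp
  have hs' : Continuous (deriv s) := hs.continuous_deriv (by simp)
  have hi : ContinuousOn (fun τ => xiConst p C * (|deriv s τ| * ‖x₂ - x₁‖) ^ q *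
      Real.exp (-m * A τ)) (Icc t₁ t₂) :=
    (continuousOn_const.mul (Continuous.rpow_const (by fun_prop)
      fun τ => Or.inr hq0.le).continuousOn).mul hκc
  -- The cost up to an intermediate time is at most the full cost, so one constant c serves for all
  -- t in (t₁, t₂].
  have hle : ∫ τ in t₁..t, xiConst p C * (|deriv s τ| * ‖x₂ - x₁‖) ^ q * Real.exp (-m * A τ) ≤
      ∫ τ in t₁..t₂, xiConst p C * (|deriv s τ| * ‖x₂ - x₁‖) ^ q * Real.exp (-m * A τ) :=
    intervalIntegral.integral_mono_interval le_rfl ht.1.le ht.2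
      (ae_of_all _ fun τ => by positivity) (hi.intervalIntegrable_of_Icc h12.le)
  have heq : ∫ τ in t₁..t₂, xiConst p C * (|deriv s τ| * ‖x₂ - x₁‖) ^ q * Real.exp (-m * A τ) =
      xiConst p C * ‖x₂ - x₁‖ ^ q * ∫ τ in t₁..t₂, |deriv s τ| ^ q * Real.exp (-m * A τ) := by
    rw [← intervalIntegral.integral_const_mul]
    congr 1; ext τ
    rw [Real.mul_rpow (abs_nonneg _) (norm_nonneg _)]
    ring
  have : xiConst p C * ‖x₂ - x₁‖ ^ q * ∫ τ in t₁..t₂, |deriv s τ| ^ q * Real.exp (-m * A τ) ≤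
      xiConst p C * ‖x₂ - x₁‖ ^ q * J := by gcongr
  linarith

/-- Smooth profiles reach every cost J above the infimum J₀ but perhaps not J₀ itself; by continuity
in J the bound survives at J₀. -/
theorem sub_mul_le_of_forall_gt {α b y J₀ : ℝ} (h : ∀ J, J₀ < J → α - b * J ≤ y) :
    α - b * J₀ ≤ y := by
  have hc : Continuous fun J : ℝ => α - b * J := by fun_prop
  refine le_of_tendsto ((hc.tendsto J₀).mono_left (nhdsWithin_le_nhds (s := Ioi J₀))) ?_
  filter_upwards [self_mem_nhdsWithin] with J hJ using h J hJ

/-- The lower bound for `r < p - 1`, valid for nonnegative `f`. -/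
theorem rpow_lower_bound {d : ℕ} {Ω : Set (EuclideanSpace ℝ (Fin d))} (hΩo : IsOpen Ω)
    (hΩc : Convex ℝ Ω) {T : ℝ} {f ft : EuclideanSpace ℝ (Fin d) × ℝ → ℝ}
    {gradf : EuclideanSpace ℝ (Fin d) × ℝ → EuclideanSpace ℝ (Fin d)}
    (hfW : IsW11locWith (spaceTimeCylinder Ω T) f ft gradf)
    (hfc : ContinuousOn f (spaceTimeCylinder Ω T)) (hfAC : ACOnC1Curves Ω T f)
    {C p r : ℝ} (hC : 0 < C) (hp : 1 < p) {a A : ℝ → ℝ}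
    (ha : LocallyIntegrableOn a (Ioo (0 : ℝ) T) volume) (hA : IsAntiderivOn a A T)
    (hnn : ∀ z ∈ spaceTimeCylinder Ω T, 0 ≤ f z)
    (hgrad : GradientIneq Ω T C p r a f ft gradf)
    {x₁ x₂ : EuclideanSpace ℝ (Fin d)} (hx₁ : x₁ ∈ Ω) (hx₂ : x₂ ∈ Ω) {t₁ t₂ : ℝ} (h0 : 0 < t₁)
    (h12 : t₁ < t₂) (h2 : t₂ < T) (hr : r < p - 1) :
    (Real.exp (A t₁) / Real.exp (A t₂)) ^ |mExp p r| *
      (f (x₁, t₁) ^ |mExp p r| - |mExp p r| * xiConst p C * ‖x₂ - x₁‖ ^ conjExp p *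
        weightInt p r A t₁ t₂ ^ (1 - conjExp p) / Real.exp (|mExp p r| * A t₁)) ≤
      f (x₂, t₂) ^ |mExp p r| := by
  have hmneg : mExp p r < 0 := by
    have : r / (p - 1) < 1 := (div_lt_one (by linarith)).2 hr
    unfold mExp; linarith
  set μ := |mExp p r| with hμ
  have hμp : 0 < μ := abs_pos.2 hmneg.ne
  have hmμ : -mExp p r = μ := (abs_of_neg hmneg).symm
  have hξ := xiConst_pos hC hp
  set J₀ := weightInt p r A t₁ t₂ ^ (1 - conjExp p) with hJ₀
  have hJ₀nn : 0 ≤ J₀ := Real.rpow_nonneg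
    (intervalIntegral.integral_nonneg h12.le fun _ _ => (Real.exp_pos _).le) _
  set f₁ := f (x₁, t₁) with hf₁
  set f₂ := f (x₂, t₂) with hf₂
  have hf₁nn : 0 ≤ f₁ := hnn _ ⟨hx₁, h0, h12.trans h2⟩
  have hf₂nn : 0 ≤ f₂ := hnn _ ⟨hx₂, h0.trans h12, h2⟩
  have hL : 0 ≤ xiConst p C * ‖x₂ - x₁‖ ^ conjExp p * J₀ := by positivity
  rcases hf₁nn.eq_or_lt with hz | hf₁p
  · have : f₁ ^ μ = 0 := by rw [← hz, Real.zero_rpow hμp.ne']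
    rw [this, zero_sub]
    refine le_trans (mul_nonpos_of_nonneg_of_nonpos (by positivity) ?_)
      (Real.rpow_nonneg hf₂nn μ)
    rw [neg_nonpos]
    have := mul_nonneg hμp.le hL
    exact div_nonneg (by linarith) (Real.exp_pos _).le
  have hG : ∀ u : ℝ, 0 < u → HasDerivAt (fun u : ℝ => u ^ μ / μ) (u ^ (-mExp p r - 1)) u := by
    intro u hu
    rw [hmμ]
    have := (Real.hasDerivAt_rpow_const (p := μ) (Or.inl hu.ne')).div_const μ
    rwa [mul_div_cancel_left₀ _ hμp.ne'] at this
  have hmain : (f₁ * Real.exp (A t₁)) ^ μ / μ - xiConst p C * ‖x₂ - x₁‖ ^ conjExp p * J₀ ≤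
      (f₂ * Real.exp (A t₂)) ^ μ / μ := by
    refine sub_mul_le_of_forall_gt fun J hJ => ?_
    rcases comparison_between_points hΩo hΩc hfW hfc hfAC hC hp ha hA hnn hgrad hx₁ hx₂ h0 h12 h2
      hf₁p hG hJ with h | h
    · exact h.2
    -- If W vanishes on the way, then c ≤ u^μ/μ for arbitrarily small u > 0. Hence c ≤ 0, and the
    -- claim is trivial.
    · refine le_trans ?_ (show 0 ≤ (f₂ * Real.exp (A t₂)) ^ μ / μ by positivity)
      by_contra! hc
      set c := (f₁ * Real.exp (A t₁)) ^ μ / μ - xiConst p C * ‖x₂ - x₁‖ ^ conjExp p * J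
      have hcont : Continuous fun u : ℝ => u ^ μ / μ :=
        (continuous_id.rpow_const fun _ => Or.inr hμp.le).div_const μ
      have h0' : (fun u : ℝ => u ^ μ / μ) 0 < c := by simpa [Real.zero_rpow hμp.ne'] using hc
      obtain ⟨δ, hδ, hball⟩ := Metric.eventually_nhds_iff.1
        (hcont.continuousAt.eventually (gt_mem_nhds h0'))
      obtain ⟨u, hu, hcu⟩ := h δ hδ
      have := hball (y := u) (by rw [Real.dist_eq, sub_zero, abs_of_pos hu.1]; exact hu.2)
      exact absurd hcu (not_le.2 this)
  rw [Real.mul_rpow hf₁nn (Real.exp_pos _).le, Real.mul_rpow hf₂nn (Real.exp_pos _).le,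
    ← Real.exp_mul, ← Real.exp_mul] at hmain
  rw [Real.div_rpow (Real.exp_pos _).le (Real.exp_pos _).le, ← Real.exp_mul, ← Real.exp_mul,
    mul_comm μ (A t₁)]
  set e₁ := Real.exp (A t₁ * μ) with he₁
  set e₂ := Real.exp (A t₂ * μ) with he₂
  have he₁p : 0 < e₁ := Real.exp_pos _
  have he₂p : 0 < e₂ := Real.exp_pos _
  have h3 := mul_le_mul_of_nonneg_left hmain hμp.le
  rw [mul_sub, mul_div_cancel₀ _ hμp.ne', mul_div_cancel₀ _ hμp.ne'] at h3
  have e : e₁ / e₂ * (f₁ ^ μ - μ * xiConst p C * ‖x₂ - x₁‖ ^ conjExp p * J₀ / e₁) =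
      (f₁ ^ μ * e₁ - μ * (xiConst p C * ‖x₂ - x₁‖ ^ conjExp p * J₀)) / e₂ := by
    field_simp
  rw [e, div_le_iff₀ he₂p]
  exact h3

/-! ### The three regimes of r and the nonnegative case -/

theorem theorem3p1 {d : ℕ} (Ω : Set (EuclideanSpace ℝ (Fin d))) (hΩo : IsOpen Ω)
    (hΩc : Convex ℝ Ω) (T : ℝ)
    (f ft : EuclideanSpace ℝ (Fin d) × ℝ → ℝ)
    (gradf : EuclideanSpace ℝ (Fin d) × ℝ → EuclideanSpace ℝ (Fin d))
    (hfW : IsW11locWith (spaceTimeCylinder Ω T) f ft gradf)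
    (hfc : ContinuousOn f (spaceTimeCylinder Ω T))
    (hfAC : ACOnC1Curves Ω T f)
    (hfN : NondiffNullOnACCurves Ω T f)
    (C p r : ℝ) (hC : 0 < C) (hp : 1 < p)
    (a A : ℝ → ℝ) (ha : LocallyIntegrableOn a (Ioo (0 : ℝ) T) volume)
    (hA : IsAntiderivOn a A T) :
    ((∀ᵐ z ∂(volume.restrict (spaceTimeCylinder Ω T)), 0 < f z) →
      GradientIneq Ω T C p r a f ft gradf →
      ∀ x₁ ∈ Ω, ∀ x₂ ∈ Ω, ∀ t₁ t₂ : ℝ, 0 < t₁ → t₁ < t₂ → t₂ < T →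
        (r = p - 1 →
          f (x₂, t₂) ≥ Real.exp (A t₁) / Real.exp (A t₂) * f (x₁, t₁) *
            Real.exp (-(xiConst p C * ‖x₂ - x₁‖ ^ conjExp p /
              (t₂ - t₁) ^ (conjExp p - 1)))) ∧
        (r > p - 1 →
          f (x₂, t₂) ≥ Real.exp (A t₁) / Real.exp (A t₂) * f (x₁, t₁) *
            (1 + mExp p r * xiConst p C * ‖x₂ - x₁‖ ^ conjExp p *
              weightInt p r A t₁ t₂ ^ (1 - conjExp p) * f (x₁, t₁) ^ mExp p r *
              Real.exp (mExp p r * A t₁)) ^ (-1 / mExp p r)) ∧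
        (r < p - 1 →
          f (x₂, t₂) ^ |mExp p r| ≥ (Real.exp (A t₁) / Real.exp (A t₂)) ^ |mExp p r| *
            (f (x₁, t₁) ^ |mExp p r| - |mExp p r| * xiConst p C * ‖x₂ - x₁‖ ^ conjExp p *
              weightInt p r A t₁ t₂ ^ (1 - conjExp p) / Real.exp (|mExp p r| * A t₁)) ∧
          (0 ≤ f (x₁, t₁) ^ |mExp p r| - |mExp p r| * xiConst p C * ‖x₂ - x₁‖ ^ conjExp p *
              weightInt p r A t₁ t₂ ^ (1 - conjExp p) / Real.exp (|mExp p r| * A t₁) →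
            f (x₂, t₂) ≥ Real.exp (A t₁) / Real.exp (A t₂) * f (x₁, t₁) *
              (1 - |mExp p r| * xiConst p C * ‖x₂ - x₁‖ ^ conjExp p *
                weightInt p r A t₁ t₂ ^ (1 - conjExp p) /
                (f (x₁, t₁) ^ |mExp p r| * Real.exp (|mExp p r| * A t₁))) ^
                (1 / |mExp p r|)))) ∧
    ((∀ᵐ z ∂(volume.restrict (spaceTimeCylinder Ω T)), 0 ≤ f z) →
      GradientIneq Ω T C p 0 a f ft gradf →
      ∀ x₁ ∈ Ω, ∀ x₂ ∈ Ω, ∀ t₁ t₂ : ℝ, 0 < t₁ → t₁ < t₂ → t₂ < T →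
        f (x₂, t₂) ^ |mExp p 0| ≥ (Real.exp (A t₁) / Real.exp (A t₂)) ^ |mExp p 0| *
          (f (x₁, t₁) ^ |mExp p 0| - |mExp p 0| * xiConst p C * ‖x₂ - x₁‖ ^ conjExp p *
            weightInt p 0 A t₁ t₂ ^ (1 - conjExp p) / Real.exp (|mExp p 0| * A t₁))) := by
  have hUo : IsOpen (spaceTimeCylinder Ω T) := hΩo.prod isOpen_Ioo
  refine ⟨fun hpos hgrad x₁ hx₁ x₂ hx₂ t₁ t₂ h0 h12 h2 => ?_,
    -- The nonnegative case is the regime r < p - 1 at r = 0, where the bound needs only f ≥ 0.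
    fun hnn hgrad x₁ hx₁ x₂ hx₂ t₁ t₂ h0 h12 h2 =>
      rpow_lower_bound hΩo hΩc hfW hfc hfAC hC hp ha hA (hfc.nonneg_of_ae_restrict hUo hnn) hgrad
        hx₁ hx₂ h0 h12 h2 (by linarith)⟩
  -- Positivity a.e. yields only f ≥ 0 at every point, so f(x₁, t₁) = 0 is treated separately in
  -- each regime; the factor f(x₁, t₁) then makes the right-hand side 0.
  have hnn := hfc.nonneg_of_ae_restrict hUo (hpos.mono fun z hz => hz.le)
  have hξ := xiConst_pos hC hp
  have hf₁nn : 0 ≤ f (x₁, t₁) := hnn _ ⟨hx₁, h0, h12.trans h2⟩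
  have hf₂nn : 0 ≤ f (x₂, t₂) := hnn _ ⟨hx₂, h0.trans h12, h2⟩
  have hJ₀nn : 0 ≤ weightInt p r A t₁ t₂ ^ (1 - conjExp p) := Real.rpow_nonneg
    (intervalIntegral.integral_nonneg h12.le fun _ _ => (Real.exp_pos _).le) _
  have he₁ := Real.exp_pos (A t₁)
  have he₂ := Real.exp_pos (A t₂)
  refine ⟨fun hr => ?_, fun hr => ?_, fun hr => ?_⟩
  · rcases hf₁nn.eq_or_lt with hz | hf₁p
    · rw [← hz]; simpa using hf₂nn
    have hm : mExp p r = 0 := by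
      unfold mExp; rw [hr, div_self (by linarith), sub_self]
    have hG : ∀ u : ℝ, 0 < u → HasDerivAt Real.log (u ^ (-mExp p r - 1)) u := by
      intro u hu
      rw [hm, neg_zero, zero_sub, Real.rpow_neg_one]
      exact Real.hasDerivAt_log hu.ne'
    have hstep : ∀ J, weightInt p r A t₁ t₂ ^ (1 - conjExp p) < J →
        0 < f (x₂, t₂) * Real.exp (A t₂) ∧ Real.log (f (x₁, t₁) * Real.exp (A t₁)) -
          xiConst p C * ‖x₂ - x₁‖ ^ conjExp p * J ≤ Real.log (f (x₂, t₂) * Real.exp (A t₂)) := by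
      intro J hJ
      rcases comparison_between_points hΩo hΩc hfW hfc hfAC hC hp ha hA hnn hgrad hx₁ hx₂ h0 h12
        h2 hf₁p hG hJ with h | h
      · exact h
      · exfalso
        set c := Real.log (f (x₁, t₁) * Real.exp (A t₁)) -
          xiConst p C * ‖x₂ - x₁‖ ^ conjExp p * J
        -- Since log u < c for u < e^c, a zero of W along the curve is impossible.
        obtain ⟨u, hu, hcu⟩ := h (Real.exp c) (Real.exp_pos c)
        exact absurd hu.2 (not_lt.2 ((Real.le_log_iff_exp_le hu.1).1 hcu))
    have hW₂ := (hstep _ (lt_add_one _)).1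
    have hlog := sub_mul_le_of_forall_gt fun J hJ => (hstep J hJ).2
    have hI : weightInt p r A t₁ t₂ = t₂ - t₁ := by simp [weightInt, hm]
    have hlen : 0 < t₂ - t₁ := by linarith
    rw [hI, show (1 - conjExp p) = -(conjExp p - 1) by ring, Real.rpow_neg hlen.le,
      ← div_eq_mul_inv, Real.le_log_iff_exp_le hW₂, sub_eq_add_neg, Real.exp_add,
      Real.exp_log (mul_pos hf₁p he₁)] at hlog
    rw [ge_iff_le, div_mul_eq_mul_div, div_mul_eq_mul_div, div_le_iff₀ he₂]
    linarith
  · rcases hf₁nn.eq_or_lt with hz | hf₁p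
    · rw [← hz]; simpa using hf₂nn
    set m := mExp p r with hmdef
    have hm : 0 < m := by
      have : 1 < r / (p - 1) := (one_lt_div (by linarith)).2 hr
      rw [hmdef]; unfold mExp; linarith
    have hG : ∀ u : ℝ, 0 < u →
        HasDerivAt (fun u : ℝ => u ^ (-m) / (-m)) (u ^ (-m - 1)) u := by
      intro u hu
      have := (Real.hasDerivAt_rpow_const (p := -m) (Or.inl hu.ne')).div_const (-m)
      rwa [mul_div_cancel_left₀ _ (neg_ne_zero.2 hm.ne')] at this
    set W₁ := f (x₁, t₁) * Real.exp (A t₁) with hW₁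
    set W₂ := f (x₂, t₂) * Real.exp (A t₂) with hW₂
    have hW₁p : 0 < W₁ := mul_pos hf₁p he₁
    have hstep : ∀ J, weightInt p r A t₁ t₂ ^ (1 - conjExp p) < J →
        0 < W₂ ∧ W₁ ^ (-m) / (-m) - xiConst p C * ‖x₂ - x₁‖ ^ conjExp p * J ≤
          W₂ ^ (-m) / (-m) := by
      intro J hJ
      rcases comparison_between_points hΩo hΩc hfW hfc hfAC hC hp ha hA hnn hgrad hx₁ hx₂ h0 h12
        h2 hf₁p hG hJ with h | h
      · exact h
      · exfalso
        have hJnn : 0 < J := hJ₀nn.trans_lt hJ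
        set c := W₁ ^ (-m) / (-m) - xiConst p C * ‖x₂ - x₁‖ ^ conjExp p * J with hc
        have hcm : 0 < -m * c := by
          have : -m * c = W₁ ^ (-m) + m * (xiConst p C * ‖x₂ - x₁‖ ^ conjExp p * J) := by
            rw [hc]; field_simp; ring
          rw [this]; positivity
        -- The threshold is the solution u of -u^(-m)/m = c, which exists because c < 0. Below it
        -- G(u) < c, so W cannot vanish here either.
        obtain ⟨u, hu, hcu⟩ := h ((-m * c) ^ (-m)⁻¹) (by positivity)
        have h1 : (-m * c) < u ^ (-m) := by
          have := Real.rpow_lt_rpow_of_neg hu.1 hu.2 (neg_lt_zero.2 hm)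
          rwa [← Real.rpow_mul hcm.le, inv_mul_cancel₀ (neg_ne_zero.2 hm.ne'),
            Real.rpow_one] at this
        rw [le_div_iff_of_neg (neg_lt_zero.2 hm)] at hcu
        linarith
    have hW₂p := (hstep _ (lt_add_one _)).1
    have hmain := sub_mul_le_of_forall_gt fun J hJ => (hstep J hJ).2
    set L := xiConst p C * ‖x₂ - x₁‖ ^ conjExp p * weightInt p r A t₁ t₂ ^ (1 - conjExp p) with hL
    have hLnn : 0 ≤ L := by positivity
    have hpow : W₂ ^ (-m) ≤ W₁ ^ (-m) * (1 + m * L * W₁ ^ m) := by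
      rw [le_div_iff_of_neg (neg_lt_zero.2 hm)] at hmain
      have e : (W₁ ^ (-m) / (-m) - L) * (-m) = W₁ ^ (-m) + m * L := by field_simp; ring
      have e' : W₁ ^ (-m) * (1 + m * L * W₁ ^ m) = W₁ ^ (-m) + m * L := by
        rw [Real.rpow_neg hW₁p.le]; field_simp
      rw [e', ← e]; exact hmain
    have hfac : 0 < 1 + m * L * W₁ ^ m := by positivity
    -- The exponent -1/m is negative, so the upper bound on W₂^(-m) becomes a lower bound on W₂.
    have hroot := Real.rpow_le_rpow_of_nonpos (z := -1 / m) (by positivity) hpow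
      (div_nonpos_of_nonpos_of_nonneg (by norm_num) hm.le)
    have hmm : -m * (-1 / m) = 1 := by field_simp
    rw [Real.mul_rpow (by positivity) hfac.le, ← Real.rpow_mul hW₁p.le, ← Real.rpow_mul hW₂p.le,
      hmm, Real.rpow_one, Real.rpow_one] at hroot
    have e : 1 + m * xiConst p C * ‖x₂ - x₁‖ ^ conjExp p *
        weightInt p r A t₁ t₂ ^ (1 - conjExp p) * f (x₁, t₁) ^ m * Real.exp (m * A t₁) =
        1 + m * L * W₁ ^ m := by
      rw [hW₁, Real.mul_rpow hf₁nn he₁.le, ← Real.exp_mul, mul_comm (A t₁) m, hL]; ring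
    rw [e, ge_iff_le, div_mul_eq_mul_div, div_mul_eq_mul_div, div_le_iff₀ he₂]
    linarith
  · have hbound := rpow_lower_bound hΩo hΩc hfW hfc hfAC hC hp ha hA hnn hgrad hx₁ hx₂ h0 h12 h2 hr
    refine ⟨hbound, fun hK => ?_⟩
    rcases hf₁nn.eq_or_lt with hz | hf₁p
    · rw [← hz]; simpa using hf₂nn
    have hmneg : mExp p r < 0 := by
      have : r / (p - 1) < 1 := (div_lt_one (by linarith)).2 hr
      unfold mExp; linarith
    have hμp : 0 < |mExp p r| := abs_pos.2 hmneg.ne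
    set μ := |mExp p r|
    set N := μ * xiConst p C * ‖x₂ - x₁‖ ^ conjExp p * weightInt p r A t₁ t₂ ^ (1 - conjExp p)
    set k := Real.exp (A t₁) / Real.exp (A t₂)
    have hk : 0 < k := div_pos he₁ he₂
    have hfp : 0 < f (x₁, t₁) ^ μ := Real.rpow_pos_of_pos hf₁p μ
    have hfac : f (x₁, t₁) ^ μ - N / Real.exp (μ * A t₁) =
        f (x₁, t₁) ^ μ * (1 - N / (f (x₁, t₁) ^ μ * Real.exp (μ * A t₁))) := by
      field_simp
    rw [hfac] at hK hbound
    have hK' := nonneg_of_mul_nonneg_right hK hfp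
    have hroot := Real.rpow_le_rpow (z := 1 / μ) (by positivity) hbound (by positivity)
    have hμ1 : μ * (1 / μ) = 1 := mul_one_div_cancel hμp.ne'
    rw [Real.mul_rpow (by positivity) hK, Real.mul_rpow hfp.le hK', ← Real.rpow_mul hk.le,
      ← Real.rpow_mul hf₁nn, ← Real.rpow_mul hf₂nn, hμ1, Real.rpow_one, Real.rpow_one,
      Real.rpow_one, ← mul_assoc] at hroot
    exact hroot
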